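/- Let $n\ge 0$, let $A\in\mathbb{R}^{n\times n}$ be dissipative (all its complex eigenvalues have negative real part), let $Q\in\mathbb{R}^{n\times n}$ be symmetric positive definite, and let $\gamma>0$. Let $W=(W(t))_{t\in\mathbb{R}}$ be a standard two-sided $n$-dimensional Brownian motion, with formal derivative the normalized Gaussian white noise $\xi$, $\langle\xi(\cdot+\tau)\xi(\cdot)^T\rangle=\delta(\tau)I$. Let $\eta=(\eta(t))_{t\in\mathbb{R}}$ be Ornstein–Uhlenbeck colored noise of correlation time $\gamma$, that is, a stationary process with almost surely continuous paths satisfying $$\frac{d\eta}{dt}=-\frac1\gamma\,\eta+\frac1\gamma\,\xi,$$ understood as $\eta(t)-\eta(s)=-\frac1\gamma\int_s^t\eta(u)\,du+\frac1\gamma(W(t)-W(s))$ for all $s,t\in\mathbb{R}$, almost surely. Let $x=(x(t))_{t\in\mathbb{R}}$ be a stationary process satisfying, almost surely for all $t\in\mathbb{R}$, $$\frac{dx}{dt}=Ax+\sqrt{2Q}\,\eta ,$$ where $\sqrt{2Q}$ is the positive semidefinite square root. (A process is stationary if its finite-dimensional distributions are invariant under time shifts.) Then $x(t)$ has finite second moments,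 and the correlation function $K(\tau)=\langle x(t+\tau)x(t)^T\rangle\in\mathbb{R}^{n\times n}$ does not depend on $t$ and is twice continuously differentiable in $\tau\in\mathbb{R}$. It satisfies $$K''(0)=A\,K'(0)-\frac1\gamma\bigl(K'(0)-A\,K(0)\bigr),\tag{1}$$ a relation in which $Q$ does not occur. Moreover $I-\gamma A$ is invertible and, with $B=(I-\gamma A)^{-1}$ and $\mathrm{Sym}(X)=X+X^T$, $$0=\mathrm{Sym}\bigl(A\,K(0)+Q\,B^T\bigr).\tag{2}$$ These relations determine $A$ and $Q$ from $\gamma$, $K(0)$, $K'(0)$ and $K''(0)$: given these data, $A$ is the only matrix in $\mathbb{R}^{n\times n}$ that satisfies (1), and $(A,Q)$ is the only pair in $\mathbb{R}^{n\times n}\times\mathbb{R}^{n\times n}$ with symmetric second entry that satisfies (1) and (2). -/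

import Mathlib

open MeasureTheory ProbabilityTheory
open scoped Matrix MatrixOrder

namespace ColoredLIM

/-- A real square matrix is dissipative if all its (complex) eigenvalues have negative real part. -/
def IsDissipative {n : ℕ} (A : Matrix (Fin n) (Fin n) ℝ) : Prop :=
  ∀ z ∈ spectrum ℂ (A.map (algebraMap ℝ ℂ)), z.re < 0

/-- The positive semidefinite square root `√(2Q)` of `2Q`. -/
noncomputable def sqrtTwo {n : ℕ} (Q : Matrix (Fin n) (Fin n) ℝ) : Matrix (Fin n) (Fin n) ℝ :=
  CFC.sqrt ((2 : ℝ) • Q)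

/-- `Sym X = X + Xᵀ`, without a factor one half. -/
def Sym {n : ℕ} (X : Matrix (Fin n) (Fin n) ℝ) : Matrix (Fin n) (Fin n) ℝ := X + Xᵀ

/-- A standard `n`-dimensional Brownian motion on the whole time axis: it vanishes at time `0`, has
almost surely continuous paths and independent increments, and the coordinates of `W t - W s` are
independent centered Gaussians of variance `t - s`. Its formal derivative is the normalized Gaussian
white noise `ξ`, with `⟨ξ(t + τ) ξ(t)ᵀ⟩ = δ(τ) I`. -/
structure IsBrownianMotion {Ω : Type*} [MeasurableSpace Ω] {n : ℕ}
    (W : ℝ → Ω → Fin n → ℝ) (P : Measure Ω) : Prop where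
  zero : ∀ᵐ ω ∂P, W 0 ω = 0
  continuous : ∀ᵐ ω ∂P, Continuous fun t => W t ω
  indep : HasIndepIncrements W P
  law : ∀ s t : ℝ, s ≤ t →
    HasLaw (fun ω => W t ω - W s ω)
      (Measure.pi fun _ : Fin n => gaussianReal 0 (t - s).toNNReal) P

/-- A process indexed by `ℝ` is (strictly) stationary if its finite-dimensional laws are invariant
under time shifts. -/
def IsStationary {Ω : Type*} [MeasurableSpace Ω] {n : ℕ}
    (X : ℝ → Ω → Fin n → ℝ) (P : Measure Ω) : Prop :=
  ∀ (I : Finset ℝ) (h : ℝ),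
    IdentDistrib (fun ω (t : I) => X (t + h) ω) (fun ω (t : I) => X t ω) P P

/-- Ornstein-Uhlenbeck colored noise of correlation time `γ` driven by `W`: a stationary process
with continuous paths that solves `dη = -(1/γ) η dt + (1/γ) dW`, in integrated form. -/
structure IsColoredNoise {Ω : Type*} [MeasurableSpace Ω] {n : ℕ} (γ : ℝ)
    (W η : ℝ → Ω → Fin n → ℝ) (P : Measure Ω) : Prop where
  stationary : IsStationary η P
  continuous : ∀ᵐ ω ∂P, Continuous fun t => η t ω
  equation : ∀ᵐ ω ∂P, ∀ s t : ℝ,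
    η t ω - η s ω = (∫ u in s..t, -(1 / γ) • η u ω) + (1 / γ) • (W t ω - W s ω)

/-- A stationary solution of `dx/dt = A x + √(2Q) η` (a random ODE, as `η` is continuous). -/
structure IsStationarySolution {Ω : Type*} [MeasurableSpace Ω] {n : ℕ}
    (A Q : Matrix (Fin n) (Fin n) ℝ) (η x : ℝ → Ω → Fin n → ℝ) (P : Measure Ω) : Prop where
  stationary : IsStationary x P
  equation : ∀ᵐ ω ∂P, ∀ t : ℝ,
    HasDerivAt (fun s => x s ω) (A *ᵥ x t ω + sqrtTwo Q *ᵥ η t ω) t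

/-- The correlation function at lag `τ`, `K(τ) = ⟨x(τ) x(0)ᵀ⟩`. -/
noncomputable def corr {Ω : Type*} [MeasurableSpace Ω] {n : ℕ}
    (x : ℝ → Ω → Fin n → ℝ) (P : Measure Ω) (τ : ℝ) : Matrix (Fin n) (Fin n) ℝ :=
  Matrix.of fun i j => ∫ ω, x τ ω i * x 0 ω j ∂P

/-- Entrywise (two-sided) derivative of a matrix-valued function. -/
noncomputable def matDeriv {n : ℕ} (K : ℝ → Matrix (Fin n) (Fin n) ℝ) (τ : ℝ) :
    Matrix (Fin n) (Fin n) ℝ :=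
  Matrix.of fun i j => deriv (fun s => K s i j) τ

/-- The relation `K''(0) = A K'(0) - (1/γ) (K'(0) - A K(0))`. -/
def ColoredDynamics {n : ℕ} (γ : ℝ) (K : ℝ → Matrix (Fin n) (Fin n) ℝ)
    (A : Matrix (Fin n) (Fin n) ℝ) : Prop :=
  matDeriv (matDeriv K) 0 = A * matDeriv K 0 - (1 / γ) • (matDeriv K 0 - A * K 0)

/-- The colored fluctuation-dissipation relation `0 = Sym (A K(0) + Q Bᵀ)`, `B = (I - γ A)⁻¹`. -/
def ColoredFDR {n : ℕ} (γ : ℝ) (K : ℝ → Matrix (Fin n) (Fin n) ℝ)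
    (A Q : Matrix (Fin n) (Fin n) ℝ) : Prop :=
  0 = Sym (A * K 0 + Q * ((1 - γ • A)⁻¹)ᵀ)

end ColoredLIM

/-! The coordinates of `W`, `η` and `x` are treated as curves `W`, `N`, `X` in the Hilbert space L²,
where correlations are inner products and no stochastic integral is needed (`MeanSquareModel`).

Integrability is not assumed. Stationarity supplies it: over a unit time step each relevant scalar
component contracts by a factor `q < 1` up to a forcing bounded in L², and identical marginals force
`q ^ k * z k` to vanish in probability (`eLpNorm_le_of_contraction`).

Causality is not assumed either. The pairing of `N t` or `X t` with a later increment of `W` solves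
a dissipative linear equation on a left half line and is bounded there, so it vanishes
(`IsDissipative.eq_zero_of_bounded`).

Write `K`, `J`, `L` for `K(0)`, `K'(0)`, `K''(0)`, and put `S = √(2Q)`, `C = ⟨N Xᵀ⟩`. Stationarity
of `x` gives `Jᵀ = -J` and `K''(τ) = -⟨X'(τ) X'(0)ᵀ⟩`, while `X' = A X + S N` gives `J = A K + S C`.
Constancy of `⟨N Nᵀ⟩` and `⟨N Xᵀ⟩`, with causality, yields `⟨N Nᵀ⟩ = I / (2γ)` and `⟨N X'ᵀ⟩ = C /
γ`. Hence `L = A J - S C / γ`, which is (1), and `2 C (I - γ A)ᵀ = S`, so that `S C = Q Bᵀ`; then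
(2) says `Sym J = 0`.

Equation (1) reads `A (J + K / γ) = L + J / γ`. A vector `u` killed by `J + K / γ` has `uᵀ K u = 0`
because `J` is antisymmetric; so `u · X = 0` in L², `C u = 0`, and `u = 0` since `C` is invertible.
Given `A`, (2) fixes `Q` up to a solution of a homogeneous Lyapunov equation, which is zero. -/

namespace ColoredLIM

/-! ### Dissipative matrices: induction along generalized eigenvectors, and the Lyapunov equation.
-/

/-- A submodule that contains `w` as soon as it contains `(T - μ) w` for an eigenvalue `μ` of `T`
contains all generalized eigenspaces, hence everything. -/
theorem submodule_eq_top_of_eigen {V : Type*} [AddCommGroup V] [Module ℂ V]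
    [FiniteDimensional ℂ V] (T : Module.End ℂ V) (U : Submodule ℂ V)
    (h : ∀ μ, T.HasEigenvalue μ → ∀ w, T w - μ • w ∈ U → w ∈ U) : U = ⊤ := by
  rw [eq_top_iff, ← Module.End.iSup_maxGenEigenspace_eq_top T, iSup_le_iff]
  intro μ w hw
  obtain ⟨k, hk⟩ := Module.End.mem_maxGenEigenspace T μ w |>.1 hw
  clear hw
  induction k generalizing w with
  | zero =>
    have : w = 0 := by simpa using hk
    simp [this]
  | succ k ih =>
    have h1 : T w - μ • w ∈ U := by
      apply ih
      rw [pow_succ] at hk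
      simpa using hk
    by_cases hμ : T.HasEigenvalue μ
    · exact h μ hμ w h1
    · have hinj : Function.Injective (T - μ • (1 : Module.End ℂ V)) := by
        rw [← LinearMap.ker_eq_bot]
        by_contra hne
        apply hμ
        rw [Module.End.hasEigenvalue_iff, Module.End.eigenspace_def]
        simpa [Algebra.algebraMap_eq_smul_one] using hne
      have hpow : Function.Injective ((T - μ • (1 : Module.End ℂ V)) ^ (k + 1)) := by
        rw [Module.End.coe_pow]
        exact hinj.iterate _
      have : w = 0 := hpow (by simpa using hk)
      simp [this]

section Dissipative

variable {n : ℕ} {A : Matrix (Fin n) (Fin n) ℝ}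

theorem isUnit_algebraMap_sub_transpose {z : ℂ} (hA : IsDissipative A) (hz : 0 ≤ z.re) :
    IsUnit (z • (1 : Matrix (Fin n) (Fin n) ℂ) - (A.map (algebraMap ℝ ℂ))ᵀ) := by
  have h : z ∉ spectrum ℂ (A.map (algebraMap ℝ ℂ)) := fun h => absurd (hA z h) (by linarith)
  rw [spectrum.notMem_iff, Algebra.algebraMap_eq_smul_one] at h
  rw [← Matrix.isUnit_transpose]
  simpa using h

/-- The induction principle `submodule_eq_top_of_eigen` for the transpose of a dissipative matrix:
only `μ` with negative real part have to be considered. -/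
theorem IsDissipative.mem_of_eigen (hA : IsDissipative A) (U : Submodule ℂ (Fin n → ℂ))
    (h : ∀ μ : ℂ, μ.re < 0 → ∀ w, (A.map (algebraMap ℝ ℂ))ᵀ *ᵥ w - μ • w ∈ U → w ∈ U)
    (w : Fin n → ℂ) : w ∈ U := by
  have : U = ⊤ := by
    refine submodule_eq_top_of_eigen (Matrix.toLin' (A.map (algebraMap ℝ ℂ))ᵀ) U ?_
    intro μ hμ w hw
    refine h μ ?_ w (by simpa using hw)
    by_contra hre
    have h1 := isUnit_algebraMap_sub_transpose hA (not_lt.1 hre)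
    obtain ⟨v, hv⟩ := hμ.exists_hasEigenvector
    have hv1 := hv.apply_eq_smul
    rw [Matrix.toLin'_apply] at hv1
    have h2 : (μ • (1 : Matrix (Fin n) (Fin n) ℂ) - (A.map (algebraMap ℝ ℂ))ᵀ) *ᵥ v = 0 := by
      rw [Matrix.sub_mulVec, hv1, Matrix.smul_mulVec, Matrix.one_mulVec, sub_self]
    exact hv.2 (Matrix.mulVec_injective_of_isUnit h1 (by simpa using h2))
  simp [this]

/-- Up to the factor `γ` this matrix is `1/γ - A`, and `1/γ > 0` is not an eigenvalue of `A`. The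
passage from ℂ to ℝ goes through the determinant. -/
theorem IsDissipative.isUnit_one_sub (hA : IsDissipative A) {γ : ℝ} (hγ : 0 < γ) :
    IsUnit (1 - γ • A) := by
  have h := isUnit_algebraMap_sub_transpose (z := ((γ⁻¹ : ℝ) : ℂ)) hA
    (by simpa using hγ.le)
  rw [← Matrix.isUnit_transpose, Matrix.isUnit_iff_isUnit_det] at h
  have h2 : ((((γ⁻¹ : ℝ) : ℂ)) • (1 : Matrix (Fin n) (Fin n) ℂ) - (A.map (algebraMap ℝ ℂ))ᵀ)ᵀ
      = (algebraMap ℝ ℂ).mapMatrix (γ⁻¹ • (1 - γ • A)) := by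
    ext i j
    simp [Matrix.one_apply, mul_sub, hγ.ne', eq_comm (a := i), apply_ite]
  rw [h2, ← RingHom.map_det, Matrix.det_smul] at h
  rw [Matrix.isUnit_iff_isUnit_det, isUnit_iff_ne_zero]
  intro h0
  rw [h0] at h
  simp at h

/-- The Lyapunov equation `(1 - γ A) D + D (1 - γ A)ᵀ = 0` has only the zero solution. -/
theorem IsDissipative.eq_zero_of_lyapunov (hA : IsDissipative A) {γ : ℝ} (hγ : 0 < γ)
    (D : Matrix (Fin n) (Fin n) ℝ) (h : (1 - γ • A) * D + D * (1 - γ • A)ᵀ = 0) : D = 0 := by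
  set f := algebraMap ℝ ℂ
  have h' : (1 - (γ : ℂ) • A.map f) * D.map f + D.map f * (1 - (γ : ℂ) • (A.map f)ᵀ) = 0 := by
    have := congrArg f.mapMatrix h
    rw [map_add, map_mul, map_mul, map_zero] at this
    have h1 : f.mapMatrix (1 - γ • A) = 1 - (γ : ℂ) • A.map f := by
      ext i j
      simp [f, Matrix.one_apply, apply_ite]
    have h2 : f.mapMatrix (1 - γ • A)ᵀ = 1 - (γ : ℂ) • (A.map f)ᵀ := by
      ext i j
      simp [f, Matrix.one_apply, apply_ite, eq_comm (a := i)]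
    rwa [h1, h2] at this
  have key : ∀ w, w ᵥ* D.map f = 0 := by
    let U : Submodule ℂ (Fin n → ℂ) := LinearMap.ker (Matrix.vecMulLinear (D.map f))
    intro w
    refine hA.mem_of_eigen U (fun μ hμ w hw => ?_) w
    have hw' : (w ᵥ* A.map f) ᵥ* D.map f = μ • (w ᵥ* D.map f) := by
      have : ((A.map f)ᵀ *ᵥ w - μ • w) ᵥ* D.map f = 0 := hw
      rw [Matrix.mulVec_transpose, Matrix.sub_vecMul, Matrix.smul_vecMul] at this
      exact sub_eq_zero.1 this
    change w ᵥ* D.map f = 0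
    have h2 := congrArg (fun M => w ᵥ* M) h'
    simp only [Matrix.vecMul_add, ← Matrix.vecMul_vecMul, Matrix.vecMul_sub, Matrix.sub_vecMul,
      Matrix.vecMul_one, Matrix.vecMul_smul, Matrix.smul_vecMul, Matrix.vecMul_zero, hw'] at h2
    -- With `w A D = μ w D`, multiplying the equation by `w` on the left leaves `γ (w D) ((2/γ - μ)
    -- - Aᵀ) = 0`. As `Re μ < 0`, the number `2/γ - μ` lies in the right half plane and the last
    -- factor is invertible.
    have hu := isUnit_algebraMap_sub_transpose (z := ((2 / γ : ℝ) : ℂ) - μ) hA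
      (by simp only [Complex.sub_re, Complex.ofReal_re]; have : 0 < 2 / γ := by positivity
          linarith)
    refine Matrix.vecMul_injective_of_isUnit hu ?_
    simp only [Matrix.vecMul_sub, Matrix.vecMul_smul, Matrix.vecMul_one, Matrix.zero_vecMul]
    have hγ' : (γ : ℂ) ≠ 0 := by exact_mod_cast hγ.ne'
    ext i
    have h3 := congrFun h2 i
    simp only [Pi.add_apply, Pi.sub_apply, Pi.smul_apply, smul_eq_mul, Pi.zero_apply] at h3 ⊢
    push_cast
    field_simp
    linear_combination h3
  ext i j
  have := congrFun (key (Pi.single i 1)) j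
  simpa [f] using this

end Dissipative

/-! ### Linear differential equations with a dissipative matrix. -/

/-- Variation of constants for a scalar equation `y' = μ y + g`, as an estimate. -/
theorem norm_le_of_hasDerivAt {y g : ℝ → ℂ} {μ : ℂ} (hμ : μ.re ≤ 0) {s t : ℝ} (hst : s ≤ t)
    (hg : Continuous g) (hy : ∀ u ∈ Set.Icc s t, HasDerivAt y (μ * y u + g u) u) :
    ‖y t‖ ≤ Real.exp (μ.re * (t - s)) * ‖y s‖ + ∫ u in s..t, ‖g u‖ := by
  have hd : ∀ u ∈ Set.uIcc s t, HasDerivAt (fun u : ℝ => Complex.exp (μ * ((t : ℂ) - u)) * y u)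
      (Complex.exp (μ * ((t : ℂ) - u)) * g u) u := by
    intro u hu
    rw [Set.uIcc_of_le hst] at hu
    have h1 : HasDerivAt (fun u : ℝ => Complex.exp (μ * ((t : ℂ) - u)))
        (Complex.exp (μ * ((t : ℂ) - u)) * (μ * (0 - 1))) u := by
      have h0 : HasDerivAt (fun u : ℝ => (u : ℂ)) 1 u := Complex.ofRealCLM.hasDerivAt
      exact (((hasDerivAt_const u (t : ℂ)).sub h0).const_mul μ).cexp
    refine (h1.mul (hy u hu)).congr_deriv ?_
    ring
  have hc : Continuous fun u : ℝ => Complex.exp (μ * ((t : ℂ) - u)) * g u := by fun_prop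
  have hI := intervalIntegral.integral_eq_sub_of_hasDerivAt hd (hc.intervalIntegrable _ _)
  simp only [sub_self, mul_zero, Complex.exp_zero, one_mul] at hI
  have hy' : y t = Complex.exp (μ * ((t : ℂ) - s)) * y s
      + ∫ u in s..t, Complex.exp (μ * ((t : ℂ) - u)) * g u := by
    rw [hI, add_sub_cancel]
  have hn : ∀ u : ℝ, ‖Complex.exp (μ * ((t : ℂ) - u))‖ = Real.exp (μ.re * (t - u)) := by
    intro u
    rw [Complex.norm_exp]
    congr 1
    rw [← Complex.ofReal_sub, Complex.re_mul_ofReal]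
  rw [hy']
  refine (norm_add_le _ _).trans (add_le_add ?_ ?_)
  · rw [norm_mul, hn]
  · refine (intervalIntegral.norm_integral_le_integral_norm hst).trans ?_
    refine intervalIntegral.integral_mono_on hst (hc.norm.intervalIntegrable _ _)
      (hg.norm.intervalIntegrable _ _) fun u hu => ?_
    rw [norm_mul, hn]
    refine mul_le_of_le_one_left (norm_nonneg _) (Real.exp_le_one_iff.2 ?_)
    exact mul_nonpos_of_nonpos_of_nonneg hμ (by linarith [hu.2])

/-- A solution of a dissipative linear equation that is bounded on a left half line vanishes. -/
theorem IsDissipative.eq_zero_of_bounded {n : ℕ} {A : Matrix (Fin n) (Fin n) ℝ}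
    (hA : IsDissipative A) {g : ℝ → Fin n → ℝ} {t₀ M : ℝ}
    (hg : ∀ t ≤ t₀, ∀ i, HasDerivAt (fun s => g s i) ((A *ᵥ g t) i) t)
    (hM : ∀ t ≤ t₀, ∀ i, |g t i| ≤ M) : ∀ t ≤ t₀, g t = 0 := by
  -- `U` consists of the functionals that vanish along `g`. If `w` is an eigenvector of `Aᵀ` modulo
  -- `U`, its pairing with `g` solves `y' = μ y`, so `‖y t‖ ≤ exp (Re μ (t - s)) * const` for every
  -- `s ≤ t`; letting `s → -∞` gives `y t = 0`.
  let U : Submodule ℂ (Fin n → ℂ) :=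
    { carrier := {w | ∀ t ≤ t₀, ∑ i, w i * (g t i : ℂ) = 0}
      add_mem' := by
        intro a b ha hb t ht
        simp [add_mul, Finset.sum_add_distrib, ha t ht, hb t ht]
      zero_mem' := by simp
      smul_mem' := by
        intro c a ha t ht
        simp [mul_assoc, ← Finset.mul_sum, ha t ht] }
  have key : ∀ w, w ∈ U := by
    refine hA.mem_of_eigen U fun μ hμ w hw => ?_
    have hd : ∀ t ≤ t₀, HasDerivAt (fun t => ∑ i, w i * (g t i : ℂ))
        (μ * (∑ i, w i * (g t i : ℂ)) + 0) t := by
      intro t ht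
      have h1 : HasDerivAt (fun t => ∑ i, w i * (g t i : ℂ))
          (∑ i, w i * (((A *ᵥ g t) i : ℝ) : ℂ)) t :=
        HasDerivAt.fun_sum fun i _ => ((hg t ht i).ofReal_comp).const_mul _
      convert h1 using 1
      have h2 := hw t ht
      simp only [Pi.sub_apply, Pi.smul_apply, smul_eq_mul, sub_mul, Finset.sum_sub_distrib,
        Matrix.mulVec, dotProduct, Matrix.transpose_apply, Matrix.map_apply,
        Complex.coe_algebraMap, sub_eq_zero] at h2
      rw [add_zero, Finset.mul_sum]
      simp only [← mul_assoc]
      rw [← h2]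
      simp only [Matrix.mulVec, dotProduct, Complex.ofReal_sum, Complex.ofReal_mul,
        Finset.mul_sum, Finset.sum_mul]
      rw [Finset.sum_comm]
      exact Finset.sum_congr rfl fun i _ => Finset.sum_congr rfl fun j _ => by ring
    have hb : ∀ t ≤ t₀, ‖∑ i, w i * (g t i : ℂ)‖ ≤ ∑ i, ‖w i‖ * M := fun t ht => by
      refine (norm_sum_le _ _).trans (Finset.sum_le_sum fun i _ => ?_)
      rw [norm_mul, Complex.norm_real]
      exact mul_le_mul_of_nonneg_left (hM t ht i) (norm_nonneg _)
    intro t ht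
    have h1 : ∀ s ≤ t, ‖∑ i, w i * (g t i : ℂ)‖
        ≤ Real.exp (μ.re * (t - s)) * ∑ i, ‖w i‖ * M := by
      intro s hs
      have := norm_le_of_hasDerivAt (y := fun t => ∑ i, w i * (g t i : ℂ)) (g := fun _ => 0)
        hμ.le hs continuous_const (fun u hu => hd u (hu.2.trans ht))
      simp only [norm_zero, intervalIntegral.integral_zero, add_zero] at this
      exact this.trans (mul_le_mul_of_nonneg_left (hb s (hs.trans ht)) (Real.exp_pos _).le)
    have h2 : Filter.Tendsto (fun s => Real.exp (μ.re * (t - s)) * ∑ i, ‖w i‖ * M)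
        Filter.atBot (nhds (0 * ∑ i, ‖w i‖ * M)) := by
      refine Filter.Tendsto.mul_const _ (Real.tendsto_exp_atBot.comp ?_)
      refine Filter.Tendsto.const_mul_atTop_of_neg hμ ?_
      exact Filter.tendsto_atTop_add_const_left _ _ Filter.tendsto_neg_atBot_atTop
    rw [zero_mul] at h2
    have h3 := ge_of_tendsto h2 ((Filter.eventually_le_atBot t).mono h1)
    exact norm_le_zero_iff.1 h3
  intro t ht
  ext i
  have := key (Pi.single i 1) t ht
  simpa [Pi.single_apply] using this

end ColoredLIM

/-! ### L² estimates for processes with continuous paths, and the contraction argument. -/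

namespace ColoredLIM

section PathIntegral

variable {Ω : Type*} [MeasurableSpace Ω] {P : Measure Ω}
  {E : Type*} [NormedAddCommGroup E] [SecondCountableTopology E] [MeasurableSpace E] [BorelSpace E]

/-- A process with almost surely continuous paths is jointly measurable, up to a null set. -/
theorem aestronglyMeasurable_uncurry [SFinite P] {f : ℝ → Ω → E} (hm : ∀ t, AEMeasurable (f t) P)
    (hc : ∀ᵐ ω ∂P, Continuous fun t => f t ω) (μ : Measure ℝ) [SFinite μ] :
    AEStronglyMeasurable (Function.uncurry f) (μ.prod P) := by
  -- Time is rounded down to a grid of mesh `1 / (k + 1)`. The rounded process involves countably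
  -- many random variables, so it is jointly measurable after replacing each by a measurable
  -- version, and all replacements share one null set. Path continuity gives the limit.
  let r : ℕ → ℝ → ℝ := fun k u => (⌊u * (k + 1)⌋ : ℝ) / (k + 1)
  have hr : ∀ u, Filter.Tendsto (fun k => r k u) Filter.atTop (nhds u) := by
    intro u
    rw [tendsto_iff_norm_sub_tendsto_zero]
    refine squeeze_zero (fun _ => norm_nonneg _) (fun k => ?_)
      (tendsto_one_div_add_atTop_nhds_zero_nat (𝕜 := ℝ))
    have hk : (0 : ℝ) < k + 1 := by positivity
    have h1 := Int.floor_le (u * (k + 1))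
    have h2 := Int.lt_floor_add_one (u * (k + 1))
    have : r k u - u = ((⌊u * (k + 1)⌋ : ℝ) - u * (k + 1)) / (k + 1) := by
      simp only [r]
      field_simp
    rw [this, norm_div, Real.norm_of_nonneg hk.le]
    gcongr
    rw [Real.norm_eq_abs, abs_le]
    constructor <;> linarith
  have hmk : ∀ᵐ ω ∂P, ∀ (k : ℕ) (j : ℤ),
      f (j / (k + 1)) ω = (hm ((j : ℝ) / (k + 1))).mk _ ω := by
    rw [ae_all_iff]
    intro k
    rw [ae_all_iff]
    exact fun j => (hm ((j : ℝ) / (k + 1))).ae_eq_mk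
  refine aestronglyMeasurable_of_tendsto_ae Filter.atTop
    (f := fun (k : ℕ) (p : ℝ × Ω) => (hm ((⌊p.1 * (k + 1)⌋ : ℝ) / (k + 1))).mk _ p.2) ?_ ?_
  · intro k
    have h1 : Measurable fun q : ℤ × Ω => (hm ((q.1 : ℝ) / (k + 1))).mk _ q.2 :=
      measurable_from_prod_countable_right fun j => (hm ((j : ℝ) / (k + 1))).measurable_mk
    have h2 : Measurable fun p : ℝ × Ω => ((⌊p.1 * (k + 1)⌋, p.2) : ℤ × Ω) :=
      (Int.measurable_floor.comp (measurable_fst.mul_const _)).prodMk measurable_snd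
    exact (h1.comp h2).aestronglyMeasurable
  · have h := (Measure.quasiMeasurePreserving_snd (μ := μ) (ν := P)).ae (hc.and hmk)
    filter_upwards [h] with p hp
    refine ((hp.1.tendsto p.1).comp (hr p.1)).congr fun k => ?_
    exact hp.2 k _

theorem eLpNorm_two_sq {G : Type*} [NormedAddCommGroup G] (h : Ω → G) :
    eLpNorm h 2 P ^ 2 = ∫⁻ ω, ‖h ω‖ₑ ^ 2 ∂P := by
  simpa using eLpNorm_nnreal_pow_eq_lintegral (μ := P) (f := h) (p := 2) two_ne_zero

/-- Minkowski's integral inequality in `L²` for processes with almost surely continuous paths. -/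
theorem eLpNorm_le_of_le_lintegral [SFinite P] {F : Type*} [NormedAddCommGroup F] {f : ℝ → Ω → E}
    (hm : ∀ t, AEMeasurable (f t) P) (hc : ∀ᵐ ω ∂P, Continuous fun t => f t ω)
    {s t : ℝ} {M : ENNReal} (hM : ∀ u ∈ Set.Ioc s t, eLpNorm (f u) 2 P ≤ M)
    {g : Ω → F} (hg : ∀ᵐ ω ∂P, ‖g ω‖ₑ ≤ ∫⁻ u in Set.Ioc s t, ‖f u ω‖ₑ) :
    eLpNorm g 2 P ≤ ENNReal.ofReal (t - s) * M := by
  have hj := aestronglyMeasurable_uncurry hm hc (volume.restrict (Set.Ioc s t))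
  -- Cauchy-Schwarz in time against the constant 1; Tonelli then exchanges the time integral with
  -- the expectation.
  have hcs : ∀ᵐ ω ∂P, (∫⁻ u in Set.Ioc s t, ‖f u ω‖ₑ) ^ 2
      ≤ ENNReal.ofReal (t - s) * ∫⁻ u in Set.Ioc s t, ‖f u ω‖ₑ ^ 2 := by
    filter_upwards [hc] with ω hω
    have h1 := ENNReal.lintegral_mul_le_Lp_mul_Lq (volume.restrict (Set.Ioc s t))
      Real.HolderConjugate.two_two (f := fun _ => 1) (g := fun u => ‖f u ω‖ₑ)
      aemeasurable_const hω.enorm.measurable.aemeasurable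
    simp only [Pi.mul_apply, one_mul, ENNReal.one_rpow, lintegral_const,
      Measure.restrict_apply MeasurableSet.univ, Set.univ_inter, Real.volume_Ioc] at h1
    have h2 := pow_le_pow_left' h1 2
    rw [mul_pow, ← ENNReal.rpow_natCast, ← ENNReal.rpow_natCast, ← ENNReal.rpow_mul,
      ← ENNReal.rpow_natCast, ← ENNReal.rpow_mul] at h2
    simpa using h2
  have hmain : ∫⁻ ω, ‖g ω‖ₑ ^ 2 ∂P ≤ (ENNReal.ofReal (t - s) * M) ^ 2 := by
    calc ∫⁻ ω, ‖g ω‖ₑ ^ 2 ∂P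
        ≤ ∫⁻ ω, (ENNReal.ofReal (t - s) * ∫⁻ u in Set.Ioc s t, ‖f u ω‖ₑ ^ 2) ∂P := by
          refine lintegral_mono_ae ?_
          filter_upwards [hg, hcs] with ω h1 h2
          exact (pow_le_pow_left' h1 2).trans h2
      _ = ENNReal.ofReal (t - s) * ∫⁻ u in Set.Ioc s t, ∫⁻ ω, ‖f u ω‖ₑ ^ 2 ∂P := by
          rw [lintegral_const_mul' _ _ ENNReal.ofReal_ne_top]
          congr 1
          exact (lintegral_lintegral_swap (f := fun u ω => ‖f u ω‖ₑ ^ 2)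
            (hj.enorm.pow_const 2)).symm
      _ ≤ ENNReal.ofReal (t - s) * ∫⁻ u in Set.Ioc s t, M ^ 2 := by
          gcongr 1
          refine setLIntegral_mono' measurableSet_Ioc fun u hu => ?_
          rw [← eLpNorm_two_sq]
          exact pow_le_pow_left' (hM u hu) 2
      _ = (ENNReal.ofReal (t - s) * M) ^ 2 := by
          rw [setLIntegral_const, Real.volume_Ioc]
          ring
  rw [← eLpNorm_two_sq] at hmain
  exact (ENNReal.pow_le_pow_left_iff two_ne_zero).1 hmain

/-- If `z k ≤ q z (k+1) + Y k` with identically distributed `z k ≥ 0`, `q < 1` and `Y k` bounded in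
`L²`, then `z 0` is in `L²`. -/
theorem eLpNorm_le_of_contraction [IsFiniteMeasure P] {z Y : ℕ → Ω → ℝ} {q : ℝ} (hq0 : 0 ≤ q) (hq1 : q < 1)
    {C : ENNReal} (hz : ∀ k, IdentDistrib (z k) (z 0) P P) (hz0 : ∀ k ω, 0 ≤ z k ω)
    (hY : ∀ k, AEStronglyMeasurable (Y k) P) (hYC : ∀ k, eLpNorm (Y k) 2 P ≤ C)
    (h : ∀ k, ∀ᵐ ω ∂P, z k ω ≤ q * z (k + 1) ω + Y k ω) :
    eLpNorm (z 0) 2 P ≤ ENNReal.ofReal (1 - q)⁻¹ * C := by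
  have hsum : ∀ᵐ ω ∂P, ∀ k, z 0 ω ≤ q ^ k * z k ω + ∑ j ∈ Finset.range k, q ^ j * Y j ω := by
    filter_upwards [ae_all_iff.2 h] with ω hω k
    induction k with
    | zero => simp
    | succ k ih =>
      rw [Finset.sum_range_succ, pow_succ]
      have := mul_le_mul_of_nonneg_left (hω k) (pow_nonneg hq0 k)
      linarith
  have hgeo : ∀ k, eLpNorm (fun ω => ∑ j ∈ Finset.range k, q ^ j * Y j ω) 2 P
      ≤ ENNReal.ofReal (1 - q)⁻¹ * C := by
    intro k
    have h1 : eLpNorm (∑ j ∈ Finset.range k, q ^ j • Y j) 2 P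
        ≤ ∑ j ∈ Finset.range k, eLpNorm (q ^ j • Y j) 2 P :=
      eLpNorm_sum_le (fun j _ => (hY j).const_smul _) one_le_two
    have h2 : (fun ω => ∑ j ∈ Finset.range k, q ^ j * Y j ω)
        = ∑ j ∈ Finset.range k, q ^ j • Y j := by
      ext ω
      simp [Finset.sum_apply]
    rw [h2]
    refine h1.trans ?_
    calc ∑ j ∈ Finset.range k, eLpNorm (q ^ j • Y j) 2 P
        ≤ ∑ j ∈ Finset.range k, ENNReal.ofReal (q ^ j) * C := by
          refine Finset.sum_le_sum fun j _ => ?_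
          rw [eLpNorm_const_smul, Real.enorm_eq_ofReal (pow_nonneg hq0 j)]
          gcongr
          exact hYC j
      _ = ENNReal.ofReal (∑ j ∈ Finset.range k, q ^ j) * C := by
          rw [← Finset.sum_mul, ENNReal.ofReal_sum_of_nonneg fun j _ => pow_nonneg hq0 j]
      _ ≤ _ := by
          gcongr
          rw [← tsum_geometric_of_lt_one hq0 hq1]
          exact (summable_geometric_of_lt_one hq0 hq1).sum_le_tsum _
            fun j _ => pow_nonneg hq0 j
  -- No moment of `z k` is available yet, but `q ^ k * z k` has the law of `q ^ k * z 0`, which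
  -- tends to 0 pointwise. Convergence in measure depends only on these laws.
  have hin : TendstoInMeasure P (fun k ω => q ^ k * z k ω) Filter.atTop fun _ => 0 := by
    have h0 : TendstoInMeasure P (fun k ω => q ^ k * z 0 ω) Filter.atTop fun _ => 0 := by
      refine tendstoInMeasure_of_tendsto_ae
        (fun k => (hz 0).aemeasurable_fst.aestronglyMeasurable.const_mul _) (ae_of_all _ fun ω => ?_)
      simpa using (tendsto_pow_atTop_nhds_zero_of_lt_one hq0 hq1).mul_const (z 0 ω)
    intro ε hε
    refine (h0 ε hε).congr fun k => ?_
    have hs : MeasurableSet {v : ℝ | ε ≤ edist (q ^ k * v) 0} := by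
      refine measurableSet_le measurable_const ?_
      fun_prop
    exact ((hz k).measure_mem_eq hs).symm
  obtain ⟨ns, -, hns⟩ := hin.exists_seq_tendsto_ae
  -- Fatou along the almost surely convergent subsequence. The bound on `z 0 - q ^ k * z k` is
  -- one-sided, so the positive part is taken; it is dominated by the geometric sum and still tends
  -- to `z 0 ≥ 0`.
  have hfatou := Lp.eLpNorm_lim_le_liminf_eLpNorm (p := 2) (μ := P)
    (f := fun i ω => max (z 0 ω - q ^ ns i * z (ns i) ω) 0)
    (fun i => (((hz 0).aemeasurable_fst.sub ((hz _).aemeasurable_fst.const_mul _)).max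
      aemeasurable_const).aestronglyMeasurable) (z 0) (by
      filter_upwards [hns] with ω hω
      have := (tendsto_const_nhds (x := z 0 ω)).sub hω
      simpa [hz0 0 ω] using this.max (tendsto_const_nhds (x := (0 : ℝ))))
  refine hfatou.trans (Filter.liminf_le_of_le (by isBoundedDefault) fun b hb => ?_)
  obtain ⟨i, hi⟩ := hb.exists
  refine hi.trans (le_trans ?_ (hgeo (ns i)))
  refine eLpNorm_mono_ae ?_
  filter_upwards [hsum, ae_all_iff.2 h] with ω hω hω'
  rw [Real.norm_of_nonneg (le_max_right _ _)]
  refine max_le ((sub_le_iff_le_add'.2 (hω _)).trans (le_abs_self _)) (norm_nonneg _)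

end PathIntegral

end ColoredLIM

/-! ### Moments of Brownian increments, of the noise and of the solution. -/

namespace ColoredLIM

section Moments

variable {Ω : Type*} [MeasurableSpace Ω] {P : Measure Ω} {n : ℕ}

theorem eLpNorm_two_eq {f : Ω → ℝ} (hf : MemLp f 2 P) :
    eLpNorm f 2 P = ENNReal.ofReal (Real.sqrt (∫ ω, f ω * f ω ∂P)) := by
  rw [hf.eLpNorm_eq_integral_rpow_norm two_ne_zero ENNReal.ofNat_ne_top, Real.sqrt_eq_rpow]
  simp [← pow_two]

theorem IsBrownianMotion.hasLaw_coord {W : ℝ → Ω → Fin n → ℝ} (hW : IsBrownianMotion W P)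
    {s t : ℝ} (hst : s ≤ t) (i : Fin n) :
    HasLaw (fun ω => W t ω i - W s ω i) (gaussianReal 0 (t - s).toNNReal) P :=
  HasLaw.comp (Y := Function.eval i)
    ⟨(measurable_pi_apply i).aemeasurable, (measurePreserving_eval _ i).map_eq⟩ (hW.law s t hst)

theorem IsBrownianMotion.aemeasurable {W : ℝ → Ω → Fin n → ℝ} (hW : IsBrownianMotion W P)
    (t : ℝ) : AEMeasurable (W t) P := by
  rcases le_total 0 t with h | h
  · refine (hW.law 0 t h).aemeasurable.congr ?_
    filter_upwards [hW.zero] with ω hω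
    simp [hω]
  · refine (hW.law t 0 h).aemeasurable.neg.congr ?_
    filter_upwards [hW.zero] with ω hω
    simp [hω]

theorem memLp_of_hasLaw_gaussianReal {f : Ω → ℝ} {m : ℝ} {v : NNReal}
    (hf : HasLaw f (gaussianReal m v) P) : MemLp f 2 P := by
  have h := memLp_id_gaussianReal (μ := m) (v := v) 2
  rw [← hf.map_eq] at h
  exact (memLp_map_measure_iff aestronglyMeasurable_id hf.aemeasurable).1 h

theorem IsBrownianMotion.memLp_sub {W : ℝ → Ω → Fin n → ℝ} (hW : IsBrownianMotion W P)
    (s t : ℝ) (i : Fin n) : MemLp (fun ω => W t ω i - W s ω i) 2 P := by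
  rcases le_total s t with h | h
  · exact memLp_of_hasLaw_gaussianReal (hW.hasLaw_coord h i)
  · exact (memLp_of_hasLaw_gaussianReal (hW.hasLaw_coord h i)).neg.ae_eq
      (ae_of_all _ fun ω => by simp)

theorem IsBrownianMotion.integral_sub {W : ℝ → Ω → Fin n → ℝ} (hW : IsBrownianMotion W P)
    {s t : ℝ} (hst : s ≤ t) (i : Fin n) : ∫ ω, (W t ω i - W s ω i) ∂P = 0 := by
  have h := (hW.hasLaw_coord hst i).integral_comp (f := id) aestronglyMeasurable_id
  simpa using h

/-- The covariance of an increment of Brownian motion. -/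
theorem IsBrownianMotion.integral_sub_mul_sub {W : ℝ → Ω → Fin n → ℝ}
    (hW : IsBrownianMotion W P) {s t : ℝ} (hst : s ≤ t) (i j : Fin n) :
    ∫ ω, (W t ω i - W s ω i) * (W t ω j - W s ω j) ∂P = if i = j then t - s else 0 := by
  set v := (t - s).toNNReal
  have hi := (hW.law s t hst).integral_comp (f := fun x : Fin n → ℝ => x i * x j)
    (by fun_prop)
  have hi' : ∫ ω, (W t ω i - W s ω i) * (W t ω j - W s ω j) ∂P
      = ∫ x : Fin n → ℝ, x i * x j ∂(Measure.pi fun _ => gaussianReal 0 v) := hi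
  rw [hi']
  have hmean : ∀ k, ∫ x : Fin n → ℝ, x k ∂(Measure.pi fun _ => gaussianReal 0 v) = 0 := by
    intro k
    have := (measurePreserving_eval (fun _ : Fin n => gaussianReal 0 v) k).hasLaw.integral_comp
      (f := id) aestronglyMeasurable_id
    simpa using this
  split_ifs with h
  · subst h
    have h1 := (measurePreserving_eval (fun _ : Fin n => gaussianReal 0 v) i).hasLaw.integral_comp
      (f := fun y : ℝ => y * y) (by fun_prop)
    have h2 := variance_of_integral_eq_zero (X := id) (μ := gaussianReal 0 v) aemeasurable_id
      (by simp)
    rw [variance_id_gaussianReal] at h2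
    calc _ = ∫ y, y * y ∂gaussianReal 0 v := h1
      _ = (v : ℝ) := by rw [h2]; simp [pow_two]
      _ = t - s := Real.coe_toNNReal _ (by linarith)
  · have h1 := (iIndepFun_pi (μ := fun _ : Fin n => gaussianReal 0 v) (X := fun _ => id)
      (fun _ => aemeasurable_id)).indepFun h
    have h2 := h1.integral_fun_mul_eq_mul_integral
      (measurable_pi_apply i).aestronglyMeasurable (measurable_pi_apply j).aestronglyMeasurable
    simp only [id] at h2
    rw [h2, hmean, zero_mul]

theorem IsBrownianMotion.integral_sub_mul_sub_eq_zero {W : ℝ → Ω → Fin n → ℝ}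
    (hW : IsBrownianMotion W P) {r s t : ℝ} (hrs : r ≤ s) (hst : s ≤ t) (i j : Fin n) :
    ∫ ω, (W s ω i - W r ω i) * (W t ω j - W s ω j) ∂P = 0 := by
  have h := (hW.indep.indepFun_sub_sub hrs hst).comp (measurable_pi_apply i) (measurable_pi_apply j)
  have h2 := h.integral_fun_mul_eq_mul_integral
    (hW.memLp_sub r s i).aestronglyMeasurable (hW.memLp_sub s t j).aestronglyMeasurable
  have h3 := hW.integral_sub hrs i
  calc _ = _ := h2
    _ = 0 := by
      have : ∫ ω, (Function.eval i ∘ (W s - W r)) ω ∂P = 0 := h3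
      rw [this, zero_mul]

theorem IsBrownianMotion.eLpNorm_sub_le_one {W : ℝ → Ω → Fin n → ℝ} (hW : IsBrownianMotion W P)
    {s t : ℝ} (hst : s ≤ t) (hts : t ≤ s + 1) (i : Fin n) :
    eLpNorm (fun ω => W t ω i - W s ω i) 2 P ≤ 1 := by
  rw [eLpNorm_two_eq (hW.memLp_sub s t i), hW.integral_sub_mul_sub hst, if_pos rfl,
    ← ENNReal.ofReal_one]
  exact ENNReal.ofReal_le_ofReal (Real.sqrt_le_one.2 (by linarith))

theorem IsStationary.identDistrib {X : ℝ → Ω → Fin n → ℝ} (hX : IsStationary X P) (s t : ℝ) :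
    IdentDistrib (X s) (X t) P P := by
  have h0 : ∀ t, IdentDistrib (X t) (X 0) P P := fun t => by
    have h := (hX {0} t).comp (measurable_pi_apply (⟨0, by simp⟩ : ({0} : Finset ℝ)))
    simpa [Function.comp_def] using h
  exact (h0 s).trans (h0 t).symm

theorem IsStationary.identDistrib_pair {X : ℝ → Ω → Fin n → ℝ} (hX : IsStationary X P)
    (τ t : ℝ) (i j : Fin n) :
    IdentDistrib (fun ω => X (t + τ) ω i * X t ω j) (fun ω => X τ ω i * X 0 ω j) P P := by
  have h := (hX {τ, 0} t).comp 
    (u := fun p : ({τ, 0} : Finset ℝ) → Fin n → ℝ => p ⟨τ, by simp⟩ i * p ⟨0, by simp⟩ j)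
    (by fun_prop)
  simpa [Function.comp_def, add_comm] using h

variable {E : Type*} [NormedAddCommGroup E] [SecondCountableTopology E] [MeasurableSpace E]
  [BorelSpace E]

theorem aestronglyMeasurable_integral_norm [SFinite P] {f : ℝ → Ω → E}
    (hm : ∀ t, AEMeasurable (f t) P)
    (hc : ∀ᵐ ω ∂P, Continuous fun t => f t ω) {s t : ℝ} (hst : s ≤ t) :
    AEStronglyMeasurable (fun ω => ∫ u in s..t, ‖f u ω‖) P := by
  simp only [intervalIntegral.integral_of_le hst]
  have h := (aestronglyMeasurable_uncurry hm hc (volume.restrict (Set.Ioc s t))).norm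
  exact AEStronglyMeasurable.integral_prod_right' (f := fun p : Ω × ℝ => ‖f p.2 p.1‖)
    h.prod_swap

theorem eLpNorm_integral_norm_le [SFinite P] {f : ℝ → Ω → E}
    (hm : ∀ t, AEMeasurable (f t) P)
    (hc : ∀ᵐ ω ∂P, Continuous fun t => f t ω) {s t : ℝ} (hst : s ≤ t)
    {M : ENNReal} (hM : ∀ u ∈ Set.Ioc s t, eLpNorm (f u) 2 P ≤ M) :
    eLpNorm (fun ω => ∫ u in s..t, ‖f u ω‖) 2 P ≤ ENNReal.ofReal (t - s) * M := by
  refine eLpNorm_le_of_le_lintegral hm hc hM (ae_of_all _ fun ω => ?_)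
  rw [intervalIntegral.integral_of_le hst]
  refine (enorm_integral_le_lintegral_enorm _).trans (le_of_eq ?_)
  simp

/-- A process with identical marginals that contracts up to a forcing bounded in `L²` is itself
bounded in `L²`. -/
theorem eLpNorm_le_of_stationary_contraction [IsFiniteMeasure P] {z R : ℝ → Ω → ℝ}
    {f : ℝ → ℝ → Ω → E} {q : ℝ} (hq0 : 0 ≤ q) (hq1 : q < 1)
    (hz : ∀ s t, IdentDistrib (z s) (z t) P P) (hz0 : ∀ t ω, 0 ≤ z t ω)
    (hm : ∀ t u, AEMeasurable (f t u) P) (hc : ∀ t, ∀ᵐ ω ∂P, Continuous fun u => f t u ω)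
    (hR : ∀ t, AEStronglyMeasurable (R t) P) {M M' : ENNReal}
    (hM : ∀ t, ∀ u ∈ Set.Ioc (t - 1) t, eLpNorm (f t u) 2 P ≤ M)
    (hM' : ∀ t, eLpNorm (R t) 2 P ≤ M')
    (h : ∀ t, ∀ᵐ ω ∂P, z t ω ≤ q * z (t - 1) ω + ((∫ u in (t - 1)..t, ‖f t u ω‖) + R t ω))
    (t : ℝ) : eLpNorm (z t) 2 P ≤ ENNReal.ofReal (1 - q)⁻¹ * (M + M') := by
  have hle : ∀ k : ℕ, t - k - 1 ≤ t - k := fun k => by linarith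
  have hI : ∀ k : ℕ, AEStronglyMeasurable
      (fun ω => ∫ u in (t - k - 1)..(t - k), ‖f (t - k) u ω‖) P := fun k =>
    aestronglyMeasurable_integral_norm (hm _) (hc _) (hle k)
  have := eLpNorm_le_of_contraction (z := fun k => z (t - k))
    (Y := fun (k : ℕ) ω => (∫ u in (t - k - 1)..(t - k), ‖f (t - k) u ω‖) + R (t - k) ω)
    hq0 hq1 (C := M + M') (fun k => hz _ _) (fun k => hz0 _) (fun k => (hI k).add (hR _))
    (fun k => (eLpNorm_add_le (hI k) (hR _) one_le_two).trans (add_le_add (by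
      have := eLpNorm_integral_norm_le (hm (t - k)) (hc (t - k)) (hle k) (hM (t - k))
      simpa using this) (hM' _)))
    (fun k => by
      have := h (t - k)
      have e : t - ((k + 1 : ℕ) : ℝ) = t - k - 1 := by push_cast; ring
      simpa only [e] using this)
  simpa using this

/-- Colored noise has finite second moments, bounded uniformly in time. -/
theorem IsColoredNoise.exists_eLpNorm_le [IsFiniteMeasure P] {γ : ℝ} (hγ : 0 < γ)
    {W η : ℝ → Ω → Fin n → ℝ} (hW : IsBrownianMotion W P) (hη : IsColoredNoise γ W η P)
    (i : Fin n) : ∃ M : ENNReal, M ≠ ⊤ ∧ ∀ t, eLpNorm (fun ω => η t ω i) 2 P ≤ M := by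
  set c : ℝ := 1 / γ
  have hcpos : 0 < c := by positivity
  -- With `s = t - 1`, the path `y = η - c (W - W s)` is differentiable and `y' = -c y - c² (W - W
  -- s)`. A unit step therefore contracts by `exp (-c)`, the forcing contributes `c * c`, and
  -- returning from `y` to `η` contributes `c`, since the increments involved have L² norm at most
  -- 1.
  refine ⟨ENNReal.ofReal (1 - Real.exp (-c))⁻¹ * (ENNReal.ofReal (c * c) + ENNReal.ofReal c),
    ENNReal.mul_ne_top ENNReal.ofReal_ne_top (by simp), fun t => ?_⟩
  have hWm : ∀ s u, AEMeasurable (fun ω => W u ω i - W s ω i) P := fun s u =>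
    (hW.memLp_sub s u i).aestronglyMeasurable.aemeasurable
  rw [← eLpNorm_norm]
  refine eLpNorm_le_of_stationary_contraction (z := fun t ω => ‖η t ω i‖)
    (R := fun t ω => c * ‖W t ω i - W (t - 1) ω i‖)
    (f := fun t u ω => (c * c) * (W u ω i - W (t - 1) ω i))
    (Real.exp_pos (-c)).le (Real.exp_lt_one_iff.2 (by linarith)) (fun s t => ?_)
    (fun _ _ => norm_nonneg _) (fun t u => (hWm _ _).const_mul _) (fun t => ?_)
    (fun t => ((hWm _ _).norm.const_mul _).aestronglyMeasurable) (fun t u hu => ?_)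
    (fun t => ?_) (fun t => ?_) t
  · exact (hη.stationary.identDistrib s t).comp (measurable_pi_apply i).norm
  · filter_upwards [hW.continuous] with ω hω
    fun_prop
  · have := eLpNorm_const_smul (μ := P) (c * c) (fun ω => W u ω i - W (t - 1) ω i) 2
    calc _ = _ := this
      _ ≤ ENNReal.ofReal (c * c) * 1 := by
        rw [Real.enorm_eq_ofReal (by positivity)]
        gcongr
        exact hW.eLpNorm_sub_le_one hu.1.le (by linarith [hu.2]) i
      _ = _ := mul_one _
  · have := eLpNorm_const_smul (μ := P) c (fun ω => ‖W t ω i - W (t - 1) ω i‖) 2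
    calc _ = _ := this
      _ ≤ ENNReal.ofReal c * 1 := by
        rw [Real.enorm_eq_ofReal hcpos.le, eLpNorm_norm]
        gcongr
        exact hW.eLpNorm_sub_le_one (by linarith) (by linarith) i
      _ = _ := mul_one _
  · filter_upwards [hη.equation, hη.continuous, hW.continuous] with ω he hηc hWc
    have hηi : Continuous fun u => η u ω i := by fun_prop
    have hWi : Continuous fun u => W u ω i := by fun_prop
    set s := t - 1 with hs
    let y : ℝ → ℝ := fun u => η u ω i - c * (W u ω i - W s ω i)
    have hy : ∀ u, y u = η s ω i + ∫ v in s..u, -c * η v ω i := by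
      intro u
      have h1 := congrFun (he s u) i
      have h2 : (∫ v in s..u, -(1 / γ) • η v ω) i = ∫ v in s..u, -c * η v ω i := by
        have := (ContinuousLinearMap.proj (R := ℝ) (φ := fun _ : Fin n => ℝ) i
          ).intervalIntegral_comp_comm
          (μ := volume) (a := s) (b := u) (f := fun v => -(1 / γ) • η v ω)
          (Continuous.intervalIntegrable (by fun_prop) _ _)
        rw [ContinuousLinearMap.proj_apply] at this
        rw [← this]
        rfl
      simp only [Pi.add_apply, Pi.sub_apply, Pi.smul_apply, smul_eq_mul, h2] at h1
      simp only [y]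
      linarith
    have hd : ∀ u, HasDerivAt (fun u => (y u : ℂ))
        (((-c : ℝ) : ℂ) * (y u : ℂ) + ((-(c * c) * (W u ω i - W s ω i) : ℝ) : ℂ)) u := by
      intro u
      have h1 : HasDerivAt y (-c * η u ω i) u := by
        have h2 := ((show Continuous fun v => -c * η v ω i by fun_prop).integral_hasStrictDerivAt
          s u).hasDerivAt.const_add (η s ω i)
        exact h2.congr_of_eventuallyEq (Filter.Eventually.of_forall hy)
      refine h1.ofReal_comp.congr_deriv ?_
      rw [← Complex.ofReal_mul, ← Complex.ofReal_add]
      congr 1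
      simp only [y]
      ring
    have hb := norm_le_of_hasDerivAt (s := s) (t := t) (by simpa using hcpos.le) (by linarith)
      (by fun_prop) (fun u _ => hd u)
    have hys : y s = η s ω i := by simp [y]
    have hI : (∫ u in s..t, ‖((-(c * c) * (W u ω i - W s ω i) : ℝ) : ℂ)‖)
        = ∫ u in s..t, ‖c * c * (W u ω i - W s ω i)‖ := by
      simp only [Complex.norm_real, neg_mul, norm_neg]
    have hst : t - s = 1 := by rw [hs]; ring
    rw [hI, Complex.norm_real, Complex.norm_real, hys, hst, Complex.ofReal_re, mul_one] at hb
    have hηy : ‖η t ω i‖ ≤ ‖y t‖ + c * ‖W t ω i - W s ω i‖ := by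
      have : η t ω i = y t + c * (W t ω i - W s ω i) := by simp only [y]; ring
      rw [this]
      refine (norm_add_le _ _).trans_eq ?_
      rw [norm_mul, Real.norm_of_nonneg hcpos.le]
    linarith

/-- A stationary solution has finite second moments, bounded uniformly in time. -/
theorem IsStationarySolution.exists_eLpNorm_le [IsFiniteMeasure P]
    {A Q : Matrix (Fin n) (Fin n) ℝ} (hA : IsDissipative A)
    {η x : ℝ → Ω → Fin n → ℝ} (hηm : ∀ t, AEMeasurable (η t) P)
    (hηc : ∀ᵐ ω ∂P, Continuous fun t => η t ω)
    (hη : ∀ i, ∃ M : ENNReal, M ≠ ⊤ ∧ ∀ t, eLpNorm (fun ω => η t ω i) 2 P ≤ M)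
    (hx : IsStationarySolution A Q η x P)
    (i : Fin n) : ∃ M : ENNReal, M ≠ ⊤ ∧ ∀ t, eLpNorm (fun ω => x t ω i) 2 P ≤ M := by
  have hxm : ∀ t, AEMeasurable (x t) P := fun t => (hx.stationary.identDistrib t t).aemeasurable_fst
  have hxi : ∀ t i, AEMeasurable (fun ω => (x t ω i : ℂ)) P := fun t i =>
    Complex.measurable_ofReal.comp_aemeasurable ((measurable_pi_apply i).comp_aemeasurable (hxm t))
  have hηi : ∀ t i, AEMeasurable (fun ω => (η t ω i : ℂ)) P := fun t i =>
    Complex.measurable_ofReal.comp_aemeasurable ((measurable_pi_apply i).comp_aemeasurable (hηm t))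
  have hcomb : ∀ (w : Fin n → ℂ) t, AEMeasurable (fun ω => ∑ i, w i * (x t ω i : ℂ)) P :=
    fun w t => Finset.aemeasurable_fun_sum _ fun i _ => (hxi t i).const_mul _
  -- `U` consists of the functionals `w` for which `w · x` is bounded in L² uniformly in time. For
  -- `w` with `v = Aᵀ w - μ w` in `U`, the process `w · x` solves a scalar equation with decay rate
  -- `μ` and forcing `v · x + b · η`, which is already bounded in L².
  let U : Submodule ℂ (Fin n → ℂ) :=
    { carrier := {w | ∃ M : ENNReal, M ≠ ⊤ ∧
        ∀ t, eLpNorm (fun ω => ∑ i, w i * (x t ω i : ℂ)) 2 P ≤ M}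
      add_mem' := by
        rintro a b ⟨Ma, hMa, ha⟩ ⟨Mb, hMb, hb⟩
        refine ⟨Ma + Mb, ENNReal.add_ne_top.2 ⟨hMa, hMb⟩, fun t => ?_⟩
        simp only [Pi.add_apply, add_mul, Finset.sum_add_distrib]
        exact (eLpNorm_add_le (hcomb a t).aestronglyMeasurable (hcomb b t).aestronglyMeasurable
          one_le_two).trans (add_le_add (ha t) (hb t))
      zero_mem' := ⟨0, by simp, fun t => by simp⟩
      smul_mem' := by
        rintro c a ⟨Ma, hMa, ha⟩
        refine ⟨‖c‖ₑ * Ma, ENNReal.mul_ne_top (by simp) hMa, fun t => ?_⟩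
        have := eLpNorm_const_smul (μ := P) c (fun ω => ∑ i, a i * (x t ω i : ℂ)) 2
        calc _ = _ := by
              congr 1
              ext ω
              simp only [Pi.smul_apply, smul_eq_mul, mul_assoc, ← Finset.mul_sum]
          _ = _ := this
          _ ≤ _ := by
            gcongr
            exact ha t }
  have hforce : ∀ b : Fin n → ℂ, ∃ M : ENNReal, M ≠ ⊤ ∧
      ∀ t, eLpNorm (fun ω => ∑ i, b i * (η t ω i : ℂ)) 2 P ≤ M := by
    intro b
    choose M hM hηM using hη
    refine ⟨∑ i, ‖b i‖ₑ * M i, ?_, fun t => ?_⟩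
    · exact ENNReal.sum_ne_top.2 fun i _ => ENNReal.mul_ne_top (by simp) (hM i)
    · have h1 : eLpNorm (∑ i, fun ω => b i * (η t ω i : ℂ)) 2 P
          ≤ ∑ i, eLpNorm (fun ω => b i * (η t ω i : ℂ)) 2 P :=
        eLpNorm_sum_le (fun i _ => ((hηi t i).const_mul _).aestronglyMeasurable) one_le_two
      have h2 : (fun ω => ∑ i, b i * (η t ω i : ℂ)) = ∑ i, fun ω => b i * (η t ω i : ℂ) := by
        ext ω
        simp
      rw [h2]
      refine h1.trans (Finset.sum_le_sum fun i _ => ?_)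
      have h3 := eLpNorm_const_smul (μ := P) (b i) (fun ω => (η t ω i : ℂ)) 2
      calc _ = _ := h3
        _ ≤ _ := by
          gcongr
          refine le_trans (le_of_eq ?_) (hηM i t)
          exact eLpNorm_congr_norm_ae (ae_of_all _ fun ω => by simp)
  have key : ∀ w, w ∈ U := by
    refine hA.mem_of_eigen U fun μ hμ w hw => ?_
    obtain ⟨M₁, hM₁, h1⟩ := hw
    set v := (A.map (algebraMap ℝ ℂ))ᵀ *ᵥ w - μ • w
    set b : Fin n → ℂ := w ᵥ* (sqrtTwo Q).map (algebraMap ℝ ℂ)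
    obtain ⟨M₂, hM₂, h2⟩ := hforce b
    refine ⟨ENNReal.ofReal (1 - Real.exp μ.re)⁻¹ * ((M₁ + M₂) + 0),
      ENNReal.mul_ne_top ENNReal.ofReal_ne_top (by simp [hM₁, hM₂]), fun t => ?_⟩
    rw [← eLpNorm_norm]
    have hbm : ∀ t, AEMeasurable (fun ω => ∑ i, b i * (η t ω i : ℂ)) P :=
      fun t => Finset.aemeasurable_fun_sum _ fun i _ => (hηi t i).const_mul _
    refine eLpNorm_le_of_stationary_contraction (z := fun t ω => ‖∑ i, w i * (x t ω i : ℂ)‖)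
      (R := fun _ _ => 0)
      (f := fun t u ω => (∑ i, v i * (x u ω i : ℂ)) + ∑ i, b i * (η u ω i : ℂ))
      (Real.exp_pos μ.re).le (Real.exp_lt_one_iff.2 hμ) (fun s t => ?_)
      (fun _ _ => norm_nonneg _) (fun t u => (hcomb v u).add (hbm u)) (fun t => ?_)
      (fun t => aestronglyMeasurable_const) (fun t u hu => ?_)
      (fun t => by simp) (fun t => ?_) t
    · exact (hx.stationary.identDistrib s t).comp
        (u := fun p : Fin n → ℝ => ‖∑ i, w i * (p i : ℂ)‖) (by fun_prop)
    · filter_upwards [hx.equation, hηc] with ω he hω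
      have hxc : Continuous fun t => x t ω :=
        continuous_iff_continuousAt.2 fun t => (he t).continuousAt
      fun_prop
    · exact (eLpNorm_add_le (hcomb v u).aestronglyMeasurable (hbm u).aestronglyMeasurable
        one_le_two).trans (add_le_add (h1 u) (h2 u))
    · filter_upwards [hx.equation, hηc] with ω he hω
      have hxc : Continuous fun t => x t ω :=
        continuous_iff_continuousAt.2 fun t => (he t).continuousAt
      have hd : ∀ u, HasDerivAt (fun u => ∑ i, w i * (x u ω i : ℂ))
          (μ * (∑ i, w i * (x u ω i : ℂ))
            + ((∑ i, v i * (x u ω i : ℂ)) + ∑ i, b i * (η u ω i : ℂ))) u := by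
        intro u
        have h3 : HasDerivAt (fun u => ∑ i, w i * (x u ω i : ℂ))
            (∑ i, w i * (((A *ᵥ x u ω + sqrtTwo Q *ᵥ η u ω) i : ℝ) : ℂ)) u :=
          HasDerivAt.fun_sum fun i _ => ((hasDerivAt_pi.1 (he u) i).ofReal_comp).const_mul _
        refine h3.congr_deriv ?_
        have e1 : ∑ i, w i * (((A *ᵥ x u ω) i : ℝ) : ℂ)
            = μ * (∑ i, w i * (x u ω i : ℂ)) + ∑ i, v i * (x u ω i : ℂ) := by
          simp only [v, Pi.sub_apply, Pi.smul_apply, smul_eq_mul, sub_mul,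
            Finset.sum_sub_distrib, mul_assoc, ← Finset.mul_sum, add_sub_cancel]
          simp only [Matrix.mulVec, dotProduct, Matrix.transpose_apply, Matrix.map_apply,
            Complex.coe_algebraMap, Complex.ofReal_sum, Complex.ofReal_mul, Finset.mul_sum,
            Finset.sum_mul]
          rw [Finset.sum_comm]
          exact Finset.sum_congr rfl fun i _ => Finset.sum_congr rfl fun j _ => by ring
        have e2 : ∑ i, w i * (((sqrtTwo Q *ᵥ η u ω) i : ℝ) : ℂ)
            = ∑ i, b i * (η u ω i : ℂ) := by
          simp only [b, Matrix.vecMul, Matrix.mulVec, dotProduct, Matrix.map_apply,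
            Complex.coe_algebraMap, Complex.ofReal_sum, Complex.ofReal_mul, Finset.mul_sum,
            Finset.sum_mul]
          rw [Finset.sum_comm]
          exact Finset.sum_congr rfl fun i _ => Finset.sum_congr rfl fun j _ => by ring
        simp only [Pi.add_apply, Complex.ofReal_add, mul_add, Finset.sum_add_distrib, e1, e2]
        ring
      have hb := norm_le_of_hasDerivAt (s := t - 1) (t := t) hμ.le (by linarith)
        (by fun_prop) (fun u _ => hd u)
      simpa using hb
  obtain ⟨M, hM, h⟩ := key (Pi.single i 1)
  refine ⟨M, hM, fun t => le_trans (le_of_eq ?_) (h t)⟩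
  refine eLpNorm_congr_norm_ae (ae_of_all _ fun ω => ?_)
  simp [Pi.single_apply]

end Moments

end ColoredLIM

/-! ### Differentiation in mean square. -/

namespace ColoredLIM

section MeanSquareCalculus

variable {Ω : Type*} [MeasurableSpace Ω] {P : Measure Ω}

theorem inner_toLp_toLp {f g : Ω → ℝ} (hf : MemLp f 2 P) (hg : MemLp g 2 P) :
    inner ℝ (hf.toLp f) (hg.toLp g) = ∫ ω, f ω * g ω ∂P := by
  rw [L2.inner_def]
  refine integral_congr_ae ?_
  filter_upwards [hf.coeFn_toLp, hg.coeFn_toLp] with ω h1 h2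
  simp [h1, h2, mul_comm]

/-- A process whose paths are primitives of `f` is Lipschitz in mean square, with the mean square
bound of `f` as constant. -/
theorem norm_toLp_sub_toLp_le [SFinite P] {p f : ℝ → Ω → ℝ} (hp : ∀ t, MemLp (p t) 2 P)
    (hf : ∀ t, MemLp (f t) 2 P) (hc : ∀ᵐ ω ∂P, Continuous fun t => f t ω)
    (h : ∀ᵐ ω ∂P, ∀ s t, p t ω - p s ω = ∫ u in s..t, f u ω) {s t M : ℝ}
    (hM : ∀ u ∈ Set.uIcc s t, ‖(hf u).toLp (f u)‖ ≤ M) :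
    ‖(hp t).toLp (p t) - (hp s).toLp (p s)‖ ≤ M * |t - s| := by
  wlog hst : s ≤ t generalizing s t
  · rw [norm_sub_rev, abs_sub_comm]
    exact this (by rwa [Set.uIcc_comm]) (not_le.1 hst).le
  have hM0 : 0 ≤ M := (norm_nonneg _).trans (hM s Set.left_mem_uIcc)
  have hb := eLpNorm_le_of_le_lintegral (s := s) (t := t) (g := p t - p s)
    (M := ENNReal.ofReal M) (fun t => (hf t).aestronglyMeasurable.aemeasurable) hc
    (fun u hu => by
      have := hM u (by rw [Set.uIcc_of_le hst]; exact ⟨hu.1.le, hu.2⟩)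
      rw [Lp.norm_toLp] at this
      exact (ENNReal.le_ofReal_iff_toReal_le (hf u).eLpNorm_ne_top hM0).2 this)
    (by
      filter_upwards [h] with ω hω
      rw [Pi.sub_apply, hω s t, intervalIntegral.integral_of_le hst]
      exact enorm_integral_le_lintegral_enorm _)
  rw [← MemLp.toLp_sub, Lp.norm_toLp, abs_of_nonneg (sub_nonneg.2 hst)]
  refine ENNReal.toReal_le_of_le_ofReal (by have := sub_nonneg.2 hst; positivity) ?_
  rwa [mul_comm M, ENNReal.ofReal_mul (sub_nonneg.2 hst)]

/-- A process whose paths are primitives of a mean square continuous process `f` is differentiable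
in mean square, with derivative `f`. -/
theorem hasDerivAt_toLp [SFinite P] {p f : ℝ → Ω → ℝ} (hp : ∀ t, MemLp (p t) 2 P)
    (hf : ∀ t, MemLp (f t) 2 P) (hc : ∀ᵐ ω ∂P, Continuous fun t => f t ω)
    (h : ∀ᵐ ω ∂P, ∀ s t, p t ω - p s ω = ∫ u in s..t, f u ω)
    (hcont : Continuous fun t => (hf t).toLp (f t)) (t : ℝ) :
    HasDerivAt (fun t => (hp t).toLp (p t)) ((hf t).toLp (f t)) t := by
  rw [hasDerivAt_iff_isLittleO, Asymptotics.isLittleO_iff]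
  intro ε hε
  obtain ⟨δ, hδ, hball⟩ := Metric.continuous_iff.1 hcont t ε hε
  filter_upwards [Metric.ball_mem_nhds t hδ] with r hr
  -- Subtracting the linear function `u • f t` turns the integrand into `f u - f t`, of L² norm at
  -- most `ε` near `t`; the Lipschitz bound then is the required little-o estimate.
  have hp' : ∀ u, MemLp (p u - u • f t) 2 P := fun u => (hp u).sub ((hf t).const_smul u)
  have hf' : ∀ u, MemLp (f u - f t) 2 P := fun u => (hf u).sub (hf t)
  have hb := norm_toLp_sub_toLp_le (s := t) (t := r) (M := ε) hp' hf' (by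
      filter_upwards [hc] with ω hω
      simp only [Pi.sub_apply]
      fun_prop) (by
      filter_upwards [h, hc] with ω hω hcω s r
      simp only [Pi.sub_apply, Pi.smul_apply, smul_eq_mul]
      rw [intervalIntegral.integral_sub (hcω.intervalIntegrable _ _)
        (continuous_const.intervalIntegrable _ _), ← hω s r, intervalIntegral.integral_const,
        smul_eq_mul]
      ring) (fun u hu => by
      rw [MemLp.toLp_sub (hf u) (hf t), ← dist_eq_norm]
      refine (hball u ?_).le
      refine lt_of_le_of_lt ?_ (Metric.mem_ball.1 hr)
      rw [Real.dist_eq, Real.dist_eq]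
      exact Set.abs_sub_left_of_mem_uIcc hu)
  have e : ∀ u, (hp' u).toLp (p u - u • f t)
      = (hp u).toLp (p u) - u • (hf t).toLp (f t) := fun _ => rfl
  rw [e, e] at hb
  have e' : (hp r).toLp (p r) - (hp t).toLp (p t) - (r - t) • (hf t).toLp (f t)
      = (hp r).toLp (p r) - r • (hf t).toLp (f t)
        - ((hp t).toLp (p t) - t • (hf t).toLp (f t)) := by
    rw [sub_smul]
    abel
  rw [e']
  exact hb

end MeanSquareCalculus

end ColoredLIM

/-! ### The Hilbert space model: causality and the correlations of noise and solution. -/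

namespace ColoredLIM

open Filter Topology

variable {n : ℕ}

/-- Lets the vanishing result for bounded solutions on a left half line apply to the noise, whose
drift is `-(1/γ)`. -/
theorem isDissipative_neg_smul_one {c : ℝ} (hc : 0 < c) :
    IsDissipative (-c • (1 : Matrix (Fin n) (Fin n) ℝ)) := by
  intro z hz
  by_contra hre
  apply hz
  have h : z + c ≠ 0 := by
    intro h
    have := congrArg Complex.re h
    simp only [Complex.add_re, Complex.ofReal_re, Complex.zero_re] at this
    linarith [not_lt.1 hre]
  have e : algebraMap ℂ (Matrix (Fin n) (Fin n) ℂ) z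
      - (-c • (1 : Matrix (Fin n) (Fin n) ℝ)).map (algebraMap ℝ ℂ)
      = algebraMap ℂ (Matrix (Fin n) (Fin n) ℂ) (z + c) := by
    ext i j
    rcases eq_or_ne i j with rfl | hij
    · simp [Matrix.algebraMap_matrix_apply]
    · simp [Matrix.algebraMap_matrix_apply, hij]
  change IsUnit _
  rw [e]
  exact (isUnit_iff_ne_zero.2 h).map _

/-- The second order description of a colored linear model: `W`, `N`, `X` are the coordinates of
the Brownian motion, the noise and the solution, as curves in a Hilbert space. -/
structure MeanSquareModel {H : Type*} [NormedAddCommGroup H] [InnerProductSpace ℝ H]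
    (γ : ℝ) (A S : Matrix (Fin n) (Fin n) ℝ) (W N X : ℝ → Fin n → H) : Prop where
  bdd_N : ∃ M, ∀ t i, ‖N t i‖ ≤ M
  bdd_X : ∃ M, ∀ t i, ‖X t i‖ ≤ M
  -- `N` itself is as rough as `W`; only the combination without its Brownian part is
  -- differentiable.
  deriv_N : ∀ t i, HasDerivAt (fun t => N t i - (1 / γ) • W t i) (-(1 / γ) • N t i) t
  deriv_X : ∀ t i, HasDerivAt (fun t => X t i) (∑ k, A i k • X t k + ∑ k, S i k • N t k) t
  stat_N : ∀ t i j, inner ℝ (N t i) (N t j) = inner ℝ (N 0 i) (N 0 j)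
  stat_X : ∀ t τ i j, inner ℝ (X (t + τ) i) (X t j) = inner ℝ (X τ i) (X 0 j)
  orth_W : ∀ r s t i j, r ≤ s → s ≤ t → inner ℝ (W s i - W r i) (W t j - W s j) = 0
  cov_W : ∀ s t i j, s ≤ t →
    inner ℝ (W t i - W s i) (W t j - W s j) = if i = j then t - s else 0

namespace MeanSquareModel

variable {H : Type*} [NormedAddCommGroup H] [InnerProductSpace ℝ H]
  {γ : ℝ} {A S : Matrix (Fin n) (Fin n) ℝ} {W N X : ℝ → Fin n → H}

/-- Causality of the noise. Backwards from `s`, the pairing with the later increment solves `g' =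
-(1/γ) g`, because earlier increments of `W` are orthogonal to it, and it is bounded; only 0 is
possible. -/
theorem inner_N_future (h : MeanSquareModel γ A S W N X) (hγ : 0 < γ) {t s r : ℝ}
    (hts : t ≤ s) (hsr : s ≤ r) (i j : Fin n) : inner ℝ (N t i) (W r j - W s j) = 0 := by
  set V := W r j - W s j
  obtain ⟨M, hM⟩ := h.bdd_N
  -- For `t ≤ s` this equals the pairing of `N t` with `V`, since `W t` and `W s` pair equally with
  -- `V`. In this form it has a two-sided derivative, also at `t = s`.
  let g : ℝ → Fin n → ℝ := fun t i =>
    inner ℝ (N t i - (1 / γ) • W t i) V + (1 / γ) * inner ℝ (W s i) V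
  have hg : ∀ t ≤ s, ∀ i, g t i = inner ℝ (N t i) V := by
    intro t ht i
    have h0 := h.orth_W t s r i j ht hsr
    rw [inner_sub_left] at h0
    simp only [g, inner_sub_left, inner_smul_left, RCLike.conj_to_real]
    linear_combination (1 / γ) * h0
  have hz := (isDissipative_neg_smul_one (n := n) (c := 1 / γ) (by positivity)).eq_zero_of_bounded
    (g := g) (t₀ := s) (M := M * ‖V‖) (fun t ht i => ?_) (fun t ht i => ?_) t hts
  · rw [← hg t hts i, hz, Pi.zero_apply]
  · have h1 := ((h.deriv_N t i).inner ℝ (hasDerivAt_const t V)).add_const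
      ((1 / γ) * inner ℝ (W s i) V)
    refine h1.congr_deriv ?_
    rw [Matrix.smul_mulVec, Matrix.one_mulVec, Pi.smul_apply, hg t ht i, smul_eq_mul,
      inner_smul_left, inner_zero_right, zero_add]
    simp
  · rw [hg t ht i]
    exact (abs_real_inner_le_norm _ _).trans
      (mul_le_mul_of_nonneg_right (hM t i) (norm_nonneg _))

/-- Once the noise term pairs to zero, the pairing of `X` with the later increment solves `g' = A g`
on the half line and is bounded. -/
theorem inner_X_future (h : MeanSquareModel γ A S W N X) (hγ : 0 < γ) (hA : IsDissipative A)
    {t s r : ℝ} (hts : t ≤ s) (hsr : s ≤ r) (i j : Fin n) :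
    inner ℝ (X t i) (W r j - W s j) = 0 := by
  set V := W r j - W s j with hV
  obtain ⟨M, hM⟩ := h.bdd_X
  have hz := hA.eq_zero_of_bounded (g := fun t i => inner ℝ (X t i) V) (t₀ := s) (M := M * ‖V‖)
    (fun t ht i => ?_) (fun t ht i => ?_) t hts
  · exact congrFun hz i
  · refine ((h.deriv_X t i).inner ℝ (hasDerivAt_const t V)).congr_deriv ?_
    have h0 : ∀ k, inner ℝ (N t k) V = 0 := fun k => h.inner_N_future hγ ht hsr k j
    simp [inner_add_left, sum_inner, inner_smul_left, h0, Matrix.mulVec, dotProduct]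
  · exact (abs_real_inner_le_norm _ _).trans
      (mul_le_mul_of_nonneg_right (hM t i) (norm_nonneg _))

theorem tendsto_W (h : MeanSquareModel γ A S W N X) (i : Fin n) :
    Tendsto (fun t => W t i - W 0 i) (𝓝[>] 0) (𝓝 0) := by
  rw [tendsto_zero_iff_norm_tendsto_zero]
  have h1 : Tendsto (fun t : ℝ => Real.sqrt t) (𝓝[>] 0) (𝓝 0) := by
    have := Real.continuous_sqrt.tendsto 0
    rw [Real.sqrt_zero] at this
    exact this.mono_left nhdsWithin_le_nhds
  refine h1.congr' ?_
  filter_upwards [self_mem_nhdsWithin] with t ht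
  have h2 := h.cov_W 0 t i i (le_of_lt ht)
  rw [if_pos rfl, real_inner_self_eq_norm_sq, sub_zero] at h2
  have h3 := Real.sqrt_sq (norm_nonneg (W t i - W 0 i))
  rwa [h2] at h3

/-- The difference quotient at `0` of the regular part of the noise. -/
theorem tendsto_slope_N (h : MeanSquareModel γ A S W N X) (i : Fin n) :
    Tendsto (fun t : ℝ => t⁻¹ • ((N t i - N 0 i) - (1 / γ) • (W t i - W 0 i))) (𝓝[>] 0)
      (𝓝 (-(1 / γ) • N 0 i)) := by
  refine (h.deriv_N 0 i).tendsto_slope_zero_right.congr fun t => ?_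
  rw [zero_add]
  module

theorem tendsto_N (h : MeanSquareModel γ A S W N X) (i : Fin n) :
    Tendsto (fun t => N t i) (𝓝[>] 0) (𝓝 (N 0 i)) := by
  have h1 : Tendsto (fun t => N t i - (1 / γ) • W t i) (𝓝[>] 0)
      (𝓝 (N 0 i - (1 / γ) • W 0 i)) :=
    (h.deriv_N 0 i).continuousAt.tendsto.mono_left nhdsWithin_le_nhds
  have h2 := (h1.add ((h.tendsto_W i).const_smul (1 / γ))).add
    (tendsto_const_nhds (x := (1 / γ) • W 0 i))
  simp only [smul_zero, add_zero, sub_add_cancel] at h2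
  refine h2.congr fun t => ?_
  rw [smul_sub]
  abel

theorem tendsto_slope_X (h : MeanSquareModel γ A S W N X) (i : Fin n) :
    Tendsto (fun t : ℝ => t⁻¹ • (X t i - X 0 i)) (𝓝[>] 0)
      (𝓝 (∑ k, A i k • X 0 k + ∑ k, S i k • N 0 k)) := by
  simpa using (h.deriv_X 0 i).tendsto_slope_zero_right

/-- The covariance of the noise is `1 / (2γ)` times the identity. -/
theorem inner_N_N (h : MeanSquareModel γ A S W N X) (hγ : 0 < γ) (i j : Fin n) :
    inner ℝ (N 0 i) (N 0 j) = if i = j then 1 / (2 * γ) else 0 := by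
  -- Split `N t` into `N 0`, a regular increment `D` and a Brownian increment, and expand the
  -- constancy of `⟨N t, N t⟩`. Causality removes the pairings of `N 0` with the Brownian increment,
  -- whose own covariance is `t`. Dividing by `t` and letting `t → 0+` gives `-(2/γ) ⟨N, N⟩ =
  -- -(1/γ²) I`.
  set D : ℝ → Fin n → H := fun t i => (N t i - N 0 i) - (1 / γ) • (W t i - W 0 i) with hD
  have hN : ∀ t k, N t k = N 0 k + D t k + (1 / γ) • (W t k - W 0 k) := fun t k => by
    simp only [hD]
    abel
  have hs := h.tendsto_slope_N
  have hD0 : ∀ k, Tendsto (fun t => D t k) (𝓝[>] 0) (𝓝 0) := fun k => by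
    have := ((h.tendsto_N k).sub_const (N 0 k)).sub ((h.tendsto_W k).const_smul (1 / γ))
    simp only [sub_self, smul_zero] at this
    exact this
  have hlim := (((tendsto_const_nhds (x := N 0 i)).inner (𝕜 := ℝ) (hs j)).add
    ((hs i).inner (𝕜 := ℝ) (tendsto_const_nhds (x := N 0 j)))).add
    ((((hs i).inner (𝕜 := ℝ) (hD0 j)).add
      ((hs i).inner (𝕜 := ℝ) ((h.tendsto_W j).const_smul (1 / γ)))).add
      (((h.tendsto_W i).const_smul (1 / γ)).inner (𝕜 := ℝ) (hs j)))
  have hconst : Tendsto (fun _ : ℝ => -(1 / γ) * ((1 / γ) * if i = j then 1 else 0)) (𝓝[>] 0)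
      (𝓝 (-(1 / γ) * ((1 / γ) * if i = j then 1 else 0))) := tendsto_const_nhds
  have heq := tendsto_nhds_unique (hlim.congr' ?_) hconst
  · simp only [inner_smul_left, inner_smul_right, smul_zero, inner_zero_left, inner_zero_right,
      RCLike.conj_to_real, add_zero, mul_zero] at heq
    split_ifs at heq ⊢ with hij
    · field_simp at heq ⊢
      linarith
    · have hne : 1 / γ ≠ 0 := by positivity
      have : (1 / γ) * inner ℝ (N 0 i) (N 0 j) = 0 := by linarith
      exact (mul_eq_zero.1 this).resolve_left hne
  · filter_upwards [self_mem_nhdsWithin] with t ht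
    have ht0 : (0 : ℝ) < t := ht
    have h1 := h.stat_N t i j
    have h2 := h.inner_N_future hγ le_rfl ht0.le i j
    have h3 := h.inner_N_future hγ le_rfl ht0.le j i
    have h4 := h.cov_W 0 t i j ht0.le
    rw [real_inner_comm] at h3
    rw [hN t i, hN t j] at h1
    simp only [inner_add_left, inner_add_right, inner_smul_left, inner_smul_right,
      RCLike.conj_to_real, h2, h3, h4] at h1
    change inner ℝ (N 0 i) (t⁻¹ • D t j) + inner ℝ (t⁻¹ • D t i) (N 0 j)
      + (inner ℝ (t⁻¹ • D t i) (D t j) + inner ℝ (t⁻¹ • D t i) ((1 / γ) • (W t j - W 0 j))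
        + inner ℝ ((1 / γ) • (W t i - W 0 i)) (t⁻¹ • D t j)) = _
    simp only [inner_smul_left, inner_smul_right, RCLike.conj_to_real]
    split_ifs at h1 ⊢ with hij
    · field_simp at h1 ⊢
      linarith
    · field_simp at h1 ⊢
      linarith

/-- Along a stationary model, the correlation of `X'` and `X` is antisymmetric. -/
theorem inner_deriv_X (h : MeanSquareModel γ A S W N X) {X' : ℝ → Fin n → H}
    (hX' : ∀ t i, HasDerivAt (fun t => X t i) (X' t i) t) (τ : ℝ) (i j : Fin n) :
    inner ℝ (X' τ i) (X 0 j) = -inner ℝ (X τ i) (X' 0 j) := by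
  have h1 : HasDerivAt (fun t => inner ℝ (X (t + τ) i) (X t j))
      (inner ℝ (X (0 + τ) i) (X' 0 j) + inner ℝ (X' (0 + τ) i) (X 0 j)) 0 :=
    ((hX' (0 + τ) i).comp_add_const 0 τ).inner ℝ (hX' 0 j)
  have h2 : HasDerivAt (fun t => inner ℝ (X (t + τ) i) (X t j)) 0 0 := by
    simp only [h.stat_X]
    exact hasDerivAt_const _ _
  have := h1.unique h2
  rw [zero_add] at this
  linarith

/-- Differentiates the lag at zero, using stationarity of `x` alone; joint stationarity of `x` and
`η` is not among the hypotheses. -/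
theorem inner_deriv_X_const (h : MeanSquareModel γ A S W N X) {X' : ℝ → Fin n → H}
    (hX' : ∀ t i, HasDerivAt (fun t => X t i) (X' t i) t) (t : ℝ) (i j : Fin n) :
    inner ℝ (X' t i) (X t j) = inner ℝ (X' 0 i) (X 0 j) := by
  have h1 : ∀ t, HasDerivAt (fun τ => inner ℝ (X (t + τ) i) (X t j))
      (inner ℝ (X' t i) (X t j)) 0 := by
    intro t
    have h0 : HasDerivAt (fun τ => X (t + τ) i) (X' t i) 0 := by
      have := hX' (t + 0) i
      rw [add_zero] at this
      simpa using (hX' (t + 0) i).comp_const_add t 0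
    simpa using h0.inner ℝ (hasDerivAt_const 0 (X t j))
  have h2 := h1 t
  have h3 := h1 0
  simp only [h.stat_X] at h2 h3
  exact h2.unique h3

/-- The cross correlation of the noise and the solution does not depend on time. -/
theorem inner_N_X_const (h : MeanSquareModel γ A S W N X) (hS : IsUnit S) (t : ℝ) (i j : Fin n) :
    inner ℝ (N t i) (X t j) = inner ℝ (N 0 i) (X 0 j) := by
  have h1 := fun i => h.inner_deriv_X_const h.deriv_X t i j
  have h2 : ∀ i, inner ℝ (X t i) (X t j) = inner ℝ (X 0 i) (X 0 j) := fun i => by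
    simpa using h.stat_X t 0 i j
  -- In `⟨X', X⟩ = A ⟨X, X⟩ + S ⟨N, X⟩` all terms but the last are known to be constant in time, and
  -- `S` is invertible.
  have h3 : S *ᵥ (fun k => inner ℝ (N t k) (X t j)) = S *ᵥ (fun k => inner ℝ (N 0 k) (X 0 j)) := by
    ext i
    have := h1 i
    simp only [inner_add_left, sum_inner, inner_smul_left, RCLike.conj_to_real, h2] at this
    simpa [Matrix.mulVec, dotProduct] using this
  exact congrFun (Matrix.mulVec_injective_of_isUnit hS h3) i

/-- The product rule from the right at 0 for the constant function `⟨N t, X t⟩`. The Brownian part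
of the increment of `N` is paired with `X 0` only, where causality makes it vanish. -/
theorem inner_N_deriv_X (h : MeanSquareModel γ A S W N X) (hγ : 0 < γ) (hA : IsDissipative A)
    (hS : IsUnit S) (i j : Fin n) :
    inner ℝ (N 0 i) (∑ k, A j k • X 0 k + ∑ k, S j k • N 0 k)
      = (1 / γ) * inner ℝ (N 0 i) (X 0 j) := by
  have hlim := ((h.tendsto_N i).inner (𝕜 := ℝ) (h.tendsto_slope_X j)).add
    ((h.tendsto_slope_N i).inner (𝕜 := ℝ) (tendsto_const_nhds (x := X 0 j)))
  have heq := tendsto_nhds_unique (hlim.congr' ?_)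
    (tendsto_const_nhds (x := (0 : ℝ)) (f := 𝓝[>] (0 : ℝ)))
  · simp only [inner_smul_left, RCLike.conj_to_real] at heq
    linarith
  · filter_upwards [self_mem_nhdsWithin] with t ht
    have ht0 : (0 : ℝ) < t := ht
    have h1 := h.inner_N_X_const hS t i j
    have h2 := h.inner_X_future hγ hA le_rfl ht0.le j i
    rw [real_inner_comm] at h2
    simp only [inner_smul_left, inner_smul_right, RCLike.conj_to_real, inner_sub_left,
      inner_sub_right] at h2 ⊢
    linear_combination t⁻¹ * h1 - t⁻¹ * (1 / γ) * h2

end MeanSquareModel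

end ColoredLIM

/-! ### The relations for the correlation function, and uniqueness of `A` and `Q`. -/

namespace ColoredLIM

open Filter Topology

variable {n : ℕ}

theorem sqrtTwo_transpose {Q : Matrix (Fin n) (Fin n) ℝ} : (sqrtTwo Q)ᵀ = sqrtTwo Q := by
  have h : (sqrtTwo Q).PosSemidef := Matrix.nonneg_iff_posSemidef.1 (CFC.sqrt_nonneg _)
  simpa [Matrix.IsHermitian, Matrix.conjTranspose_eq_transpose_of_trivial] using h.isHermitian

theorem sqrtTwo_mul_self {Q : Matrix (Fin n) (Fin n) ℝ} (hQ : Q.PosDef) :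
    sqrtTwo Q * sqrtTwo Q = (2 : ℝ) • Q :=
  CFC.sqrt_mul_sqrt_self _ (Matrix.nonneg_iff_posSemidef.2 (hQ.posSemidef.smul zero_le_two))

theorem isUnit_sqrtTwo {Q : Matrix (Fin n) (Fin n) ℝ} (hQ : Q.PosDef) : IsUnit (sqrtTwo Q) := by
  have h : IsUnit ((2 : ℝ) • Q) := (hQ.smul two_pos).isUnit
  rw [← sqrtTwo_mul_self hQ, ← pow_two] at h
  exact (isUnit_pow_iff two_ne_zero).1 h

/-- If `A` satisfies the second-derivative identity and `K'(0) + K(0)/γ` is invertible, it is the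
only matrix that does. -/
theorem ColoredDynamics.unique {γ : ℝ} {K : ℝ → Matrix (Fin n) (Fin n) ℝ}
    {A A' : Matrix (Fin n) (Fin n) ℝ} (hG : IsUnit (matDeriv K 0 + (1 / γ) • K 0))
    (hA : ColoredDynamics γ K A) (hA' : ColoredDynamics γ K A') : A' = A := by
  have h := hA'.symm.trans hA
  refine hG.mul_left_injective ?_
  change A' * (matDeriv K 0 + (1 / γ) • K 0) = A * (matDeriv K 0 + (1 / γ) • K 0)
  rw [smul_sub, smul_sub] at h
  rw [mul_add, mul_add, Matrix.mul_smul, Matrix.mul_smul, ← sub_eq_zero]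
  rw [← sub_eq_zero] at h
  rw [← h]
  abel

/-- The fluctuation-dissipation relation determines the symmetric matrix `Q`. -/
theorem ColoredFDR.unique {γ : ℝ} (hγ : 0 < γ) {K : ℝ → Matrix (Fin n) (Fin n) ℝ}
    {A Q Q' : Matrix (Fin n) (Fin n) ℝ} (hA : IsDissipative A) (hQ : Q.IsSymm) (hQ' : Q'.IsSymm)
    (h : ColoredFDR γ K A Q) (h' : ColoredFDR γ K A Q') : Q' = Q := by
  rw [← sub_eq_zero]
  set D := Q' - Q with hD
  have hDs : Dᵀ = D := by rw [hD, Matrix.transpose_sub, hQ.eq, hQ'.eq]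
  have hM := hA.isUnit_one_sub hγ
  set M := 1 - γ • A
  have hdet := (Matrix.isUnit_iff_isUnit_det _).1 hM
  have hM1 : M * M⁻¹ = 1 := Matrix.mul_nonsing_inv _ hdet
  have hM2 : M⁻¹ᵀ * Mᵀ = 1 := by rw [← Matrix.transpose_mul, hM1, Matrix.transpose_one]
  have h0 : D * M⁻¹ᵀ + M⁻¹ * D = 0 := by
    have h1 := h'.symm.trans h
    simp only [Sym, Matrix.transpose_add, Matrix.transpose_mul, Matrix.transpose_transpose,
      hQ.eq, hQ'.eq] at h1
    rw [← sub_eq_zero] at h1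
    rw [← h1, hD, sub_mul, mul_sub]
    abel
  refine hA.eq_zero_of_lyapunov hγ D ?_
  -- Multiplying `D Bᵀ + B D = 0` by `M = B⁻¹` on the left and `Mᵀ` on the right gives the Lyapunov
  -- equation.
  calc M * D + D * Mᵀ = M * D * (M⁻¹ᵀ * Mᵀ) + (M * M⁻¹) * D * Mᵀ := by
        rw [hM1, hM2, mul_one, one_mul]
    _ = M * (D * M⁻¹ᵀ + M⁻¹ * D) * Mᵀ := by noncomm_ring
    _ = 0 := by rw [h0, mul_zero, zero_mul]

namespace MeanSquareModel

variable {H : Type*} [NormedAddCommGroup H] [InnerProductSpace ℝ H]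
  {γ : ℝ} {A Q : Matrix (Fin n) (Fin n) ℝ} {W N X : ℝ → Fin n → H}
  {K : ℝ → Matrix (Fin n) (Fin n) ℝ}

/-- The derivative is moved to the factor at time 0. The lag then enters only through `X τ`, so a
second differentiation never meets the nondifferentiable `N`. -/
theorem hasDerivAt_corr {S : Matrix (Fin n) (Fin n) ℝ} (h : MeanSquareModel γ A S W N X)
    (hK : ∀ τ i j, K τ i j = inner ℝ (X τ i) (X 0 j)) (τ : ℝ) (i j : Fin n) :
    HasDerivAt (fun τ => K τ i j)
      (-inner ℝ (X τ i) (∑ k, A j k • X 0 k + ∑ k, S j k • N 0 k)) τ := by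
  simp only [hK]
  rw [← h.inner_deriv_X h.deriv_X]
  simpa using (h.deriv_X τ i).inner ℝ (hasDerivAt_const τ (X 0 j))

theorem hasDerivAt_deriv_corr {S : Matrix (Fin n) (Fin n) ℝ} (h : MeanSquareModel γ A S W N X)
    (hK : ∀ τ i j, K τ i j = inner ℝ (X τ i) (X 0 j)) (τ : ℝ) (i j : Fin n) :
    HasDerivAt (deriv fun τ => K τ i j)
      (-inner ℝ (∑ k, A i k • X τ k + ∑ k, S i k • N τ k)
        (∑ k, A j k • X 0 k + ∑ k, S j k • N 0 k)) τ := by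
  have h1 : deriv (fun τ => K τ i j)
      = fun τ => -inner ℝ (X τ i) (∑ k, A j k • X 0 k + ∑ k, S j k • N 0 k) :=
    funext fun τ => (h.hasDerivAt_corr hK τ i j).deriv
  rw [h1]
  simpa using ((h.deriv_X τ i).inner ℝ
    (hasDerivAt_const τ (∑ k, A j k • X 0 k + ∑ k, S j k • N 0 k))).fun_neg

theorem contDiff_corr {S : Matrix (Fin n) (Fin n) ℝ} (h : MeanSquareModel γ A S W N X)
    (hN : ∀ i, Continuous fun t => N t i)
    (hK : ∀ τ i j, K τ i j = inner ℝ (X τ i) (X 0 j)) (i j : Fin n) :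
    ContDiff ℝ 2 fun τ => K τ i j := by
  have hX : ∀ i, Continuous fun t => X t i := fun i =>
    continuous_iff_continuousAt.2 fun t => (h.deriv_X t i).continuousAt
  rw [show (2 : WithTop ℕ∞) = 1 + 1 by norm_num, contDiff_succ_iff_deriv]
  refine ⟨fun τ => (h.hasDerivAt_corr hK τ i j).differentiableAt, by simp, ?_⟩
  rw [contDiff_one_iff_deriv]
  refine ⟨fun τ => (h.hasDerivAt_deriv_corr hK τ i j).differentiableAt, ?_⟩
  rw [funext fun τ => (h.hasDerivAt_deriv_corr hK τ i j).deriv]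
  fun_prop

/-- The relations satisfied by the correlation function of a stationary model. -/
theorem corr_relations (h : MeanSquareModel γ A (sqrtTwo Q) W N X) (hγ : 0 < γ)
    (hA : IsDissipative A) (hQ : Q.PosDef)
    (hK : ∀ τ i j, K τ i j = inner ℝ (X τ i) (X 0 j)) :
    ColoredDynamics γ K A ∧ ColoredFDR γ K A Q ∧ IsUnit (matDeriv K 0 + (1 / γ) • K 0) := by
  have hS := isUnit_sqrtTwo hQ
  have hSt := sqrtTwo_transpose (Q := Q)
  have hSS := sqrtTwo_mul_self hQ
  set S := sqrtTwo Q
  set C : Matrix (Fin n) (Fin n) ℝ := Matrix.of fun i j => inner ℝ (N 0 i) (X 0 j) with hC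
  set J := matDeriv K 0
  have hJ : ∀ i j, J i j = -inner ℝ (X 0 i) (∑ k, A j k • X 0 k + ∑ k, S j k • N 0 k) :=
    fun i j => (h.hasDerivAt_corr hK 0 i j).deriv
  have hJ' : ∀ i j, J i j = inner ℝ (∑ k, A i k • X 0 k + ∑ k, S i k • N 0 k) (X 0 j) :=
    fun i j => by rw [hJ, h.inner_deriv_X h.deriv_X]
  have hJeq : J = A * K 0 + S * C := by
    ext i j
    rw [hJ']
    simp [inner_add_left, sum_inner, inner_smul_left, Matrix.mul_apply, hK, hC]
  have hJt : Jᵀ = -J := by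
    ext i j
    rw [Matrix.transpose_apply, Matrix.neg_apply, hJ', hJ, neg_neg, real_inner_comm]
  -- Only the left factor of `-⟨X', X'ᵀ⟩` is expanded: `-⟨X, X'ᵀ⟩` is `J`, and `⟨N, X'ᵀ⟩` is `C /
  -- γ`.
  have hJ2 : matDeriv (matDeriv K) 0 = A * J - (1 / γ) • (S * C) := by
    ext i j
    have h1 : matDeriv (matDeriv K) 0 i j = deriv (deriv fun τ => K τ i j) 0 := rfl
    rw [h1, (h.hasDerivAt_deriv_corr hK 0 i j).deriv]
    simp only [inner_add_left, sum_inner, inner_smul_left, RCLike.conj_to_real,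
      h.inner_N_deriv_X hγ hA hS, Matrix.sub_apply, Matrix.smul_apply, smul_eq_mul,
      Matrix.mul_apply, hJ, hC, Matrix.of_apply, Finset.mul_sum, mul_neg, Finset.sum_neg_distrib]
    rw [neg_add, sub_eq_add_neg]
    congr 2
    exact Finset.sum_congr rfl fun k _ => by ring
  -- Two expressions for `⟨N, X'ᵀ⟩`: `C Aᵀ + S / (2γ)` by expansion with the noise covariance, and
  -- `C / γ`. Invertibility of `C` follows from that of `S`.
  have hCM : (2 : ℝ) • (C * (1 - γ • A)ᵀ) = S := by
    ext i j
    have h1 := h.inner_N_deriv_X hγ hA hS i j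
    have h2 : inner ℝ (N 0 i) (∑ k, A j k • X 0 k + ∑ k, S j k • N 0 k)
        = (C * Aᵀ) i j + S j i * (1 / (2 * γ)) := by
      simp [inner_add_right, inner_sum, inner_smul_right, Matrix.mul_apply, hC,
        h.inner_N_N hγ, mul_comm]
    have h3 : S j i = S i j := by rw [← Matrix.transpose_apply S, hSt]
    have h4 : inner ℝ (N 0 i) (X 0 j) = C i j := rfl
    rw [h2, h3, h4] at h1
    rw [Matrix.transpose_sub, Matrix.transpose_smul, Matrix.transpose_one, mul_sub, mul_one,
      Matrix.mul_smul, Matrix.smul_apply, Matrix.sub_apply, Matrix.smul_apply, smul_eq_mul,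
      smul_eq_mul]
    field_simp at h1
    linarith
  have hM := hA.isUnit_one_sub hγ
  have hSC : S * C = Q * ((1 - γ • A)⁻¹)ᵀ := by
    have hdet := (Matrix.isUnit_iff_isUnit_det _).1 hM
    have hM2 : (1 - γ • A)ᵀ * ((1 - γ • A)⁻¹)ᵀ = 1 := by
      rw [← Matrix.transpose_mul, Matrix.nonsing_inv_mul _ hdet, Matrix.transpose_one]
    have h1 : (2 : ℝ) • (S * C * (1 - γ • A)ᵀ) = (2 : ℝ) • Q := by
      rw [← hSS, mul_assoc, ← Matrix.mul_smul, hCM]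
    have h2 := smul_right_injective _ (two_ne_zero (α := ℝ)) h1
    calc S * C = S * C * ((1 - γ • A)ᵀ * ((1 - γ • A)⁻¹)ᵀ) := by rw [hM2, mul_one]
      _ = Q * ((1 - γ • A)⁻¹)ᵀ := by rw [← mul_assoc]; exact congrArg (· * _) h2
  have hCu : IsUnit C := by
    have h1 : IsUnit ((2 : ℝ) • (C * (1 - γ • A)ᵀ)) := by rwa [hCM]
    rw [Matrix.isUnit_iff_isUnit_det, Matrix.det_smul, Matrix.det_mul] at h1
    rw [Matrix.isUnit_iff_isUnit_det]
    exact isUnit_of_mul_isUnit_left (isUnit_of_mul_isUnit_right h1)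
  refine ⟨?_, ?_, ?_⟩
  · change matDeriv (matDeriv K) 0 = A * J - (1 / γ) • (J - A * K 0)
    rw [hJ2, hJeq, add_sub_cancel_left]
  · change 0 = Sym (A * K 0 + Q * ((1 - γ • A)⁻¹)ᵀ)
    rw [← hSC, ← hJeq, Sym, hJt, add_neg_cancel]
  · rw [← Matrix.mulVec_injective_iff_isUnit]
    intro v w hvw
    rw [← sub_eq_zero]
    set u := v - w with hu
    have hGu : (J + (1 / γ) • K 0) *ᵥ u = 0 := by
      rw [hu, Matrix.mulVec_sub, sub_eq_zero]
      exact hvw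
    have h1 : u ⬝ᵥ (J *ᵥ u) = 0 := by
      have h2 : u ⬝ᵥ (J *ᵥ u) = u ⬝ᵥ (Jᵀ *ᵥ u) := by
        rw [Matrix.dotProduct_mulVec, ← Matrix.mulVec_transpose, dotProduct_comm]
      rw [hJt, Matrix.neg_mulVec, dotProduct_neg] at h2
      linarith
    have h3 : u ⬝ᵥ (K 0 *ᵥ u) = 0 := by
      have h4 := congrArg (fun y => u ⬝ᵥ y) hGu
      simp only [Matrix.add_mulVec, dotProduct_add, h1, zero_add, Matrix.smul_mulVec,
        dotProduct_smul, dotProduct_zero, smul_eq_mul] at h4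
      exact (mul_eq_zero.1 h4).resolve_left (by positivity)
    -- `uᵀ K(0) u` is the squared norm of this combination. Its vanishing passes to the pairing with
    -- `N 0`, that is, to `C u`; positivity of `K(0)` need not be known beforehand.
    have h5 : ∑ k, u k • X 0 k = 0 := by
      rw [← inner_self_eq_zero (𝕜 := ℝ)]
      refine Eq.trans ?_ h3
      simp only [sum_inner, inner_sum, inner_smul_left, inner_smul_right, RCLike.conj_to_real,
        dotProduct, Matrix.mulVec, hK, Finset.mul_sum]
      refine Finset.sum_congr rfl fun i _ => Finset.sum_congr rfl fun j _ => ?_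
      rw [real_inner_comm]
      ring
    refine Matrix.mulVec_injective_of_isUnit hCu ?_
    rw [Matrix.mulVec_zero]
    ext i
    have h6 : (C *ᵥ u) i = inner ℝ (N 0 i) (∑ k, u k • X 0 k) := by
      simp [inner_sum, inner_smul_right, Matrix.mulVec, dotProduct, hC, mul_comm]
    rw [h6, h5, inner_zero_right, Pi.zero_apply]

end MeanSquareModel

end ColoredLIM

/-! ### From the processes to the Hilbert space model. -/

namespace ColoredLIM

variable {Ω : Type*} [MeasurableSpace Ω] {P : Measure Ω} {n : ℕ}

theorem norm_toLp_le_toReal {f : Ω → ℝ} (hf : MemLp f 2 P) {M : ENNReal} (hM : M ≠ ⊤)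
    (h : eLpNorm f 2 P ≤ M) : ‖hf.toLp f‖ ≤ M.toReal := by
  rw [Lp.norm_toLp]
  exact ENNReal.toReal_mono hM h

theorem exists_norm_toLp_le {f : ℝ → Fin n → Ω → ℝ} (hf : ∀ t i, MemLp (f t i) 2 P)
    (h : ∀ i, ∃ M : ENNReal, M ≠ ⊤ ∧ ∀ t, eLpNorm (f t i) 2 P ≤ M) :
    ∃ M, ∀ t i, ‖(hf t i).toLp (f t i)‖ ≤ M := by
  choose M hM hle using h
  refine ⟨∑ i, (M i).toReal, fun t i => (norm_toLp_le_toReal (hf t i) (hM i) (hle i t)).trans ?_⟩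
  exact Finset.single_le_sum (f := fun i => (M i).toReal) (fun _ _ => ENNReal.toReal_nonneg)
    (Finset.mem_univ i)

theorem toLp_sum_mul {f : Fin n → Ω → ℝ} (hf : ∀ k, MemLp (f k) 2 P) (c : Fin n → ℝ) :
    (memLp_finsetSum Finset.univ fun k _ => (hf k).const_mul (c k)).toLp
      (fun ω => ∑ k, c k * f k ω) = ∑ k, c k • (hf k).toLp (f k) := by
  refine Lp.ext ((MemLp.coeFn_toLp _).trans ?_)
  filter_upwards [Lp.coeFn_finsetSum Finset.univ fun k => c k • (hf k).toLp (f k),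
    ae_all_iff.2 fun k => Lp.coeFn_smul (c k) ((hf k).toLp (f k)),
    ae_all_iff.2 fun k => (hf k).coeFn_toLp] with ω h1 h2 h3
  rw [h1, Finset.sum_apply]
  refine Finset.sum_congr rfl fun k _ => ?_
  rw [h2, Pi.smul_apply, h3, smul_eq_mul]

/-- Mean square continuity of a process from a Lipschitz bound in mean square. -/
theorem continuous_of_norm_sub_le {H : Type*} [NormedAddCommGroup H] {f : ℝ → H} {M : ℝ}
    (h : ∀ s t, ‖f t - f s‖ ≤ M * |t - s|) : Continuous f := by
  refine continuous_iff_continuousAt.2 fun s => ?_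
  rw [ContinuousAt, tendsto_iff_norm_sub_tendsto_zero]
  refine squeeze_zero (fun _ => norm_nonneg _) (h s) ?_
  have : Continuous fun t => M * |t - s| := by fun_prop
  simpa using this.tendsto s

/-- A stationary solution driven by colored noise is a `MeanSquareModel` in `L²`. -/
theorem exists_meanSquareModel [IsProbabilityMeasure P] {A Q : Matrix (Fin n) (Fin n) ℝ} {γ : ℝ}
    (hγ : 0 < γ) (hA : IsDissipative A) {W η x : ℝ → Ω → Fin n → ℝ}
    (hW : IsBrownianMotion W P) (hη : IsColoredNoise γ W η P)
    (hx : IsStationarySolution A Q η x P) :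
    ∃ (hX : ∀ t i, MemLp (fun ω => x t ω i) 2 P) (B N : ℝ → Fin n → Lp ℝ 2 P),
      (∀ i, Continuous fun t => N t i) ∧
      MeanSquareModel γ A (sqrtTwo Q) B N (fun t i => (hX t i).toLp (fun ω => x t ω i)) := by
  have hηm : ∀ t, AEMeasurable (η t) P := fun t => (hη.stationary.identDistrib t t).aemeasurable_fst
  have hxm : ∀ t, AEMeasurable (x t) P := fun t => (hx.stationary.identDistrib t t).aemeasurable_fst
  have hηb := fun i => hη.exists_eLpNorm_le hγ hW i
  have hxb := fun i => hx.exists_eLpNorm_le hA hηm hη.continuous hηb i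
  have hηL : ∀ t i, MemLp (fun ω => η t ω i) 2 P := fun t i => by
    obtain ⟨M, hM, h⟩ := hηb i
    exact ⟨((measurable_pi_apply i).comp_aemeasurable (hηm t)).aestronglyMeasurable,
      (h t).trans_lt hM.lt_top⟩
  have hxL : ∀ t i, MemLp (fun ω => x t ω i) 2 P := fun t i => by
    obtain ⟨M, hM, h⟩ := hxb i
    exact ⟨((measurable_pi_apply i).comp_aemeasurable (hxm t)).aestronglyMeasurable,
      (h t).trans_lt hM.lt_top⟩
  have hWL : ∀ t i, MemLp (fun ω => W t ω i) 2 P := fun t i => by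
    refine (hW.memLp_sub 0 t i).ae_eq ?_
    filter_upwards [hW.zero] with ω hω
    simp [hω]
  set B : ℝ → Fin n → Lp ℝ 2 P := fun t i => (hWL t i).toLp (fun ω => W t ω i)
  set N : ℝ → Fin n → Lp ℝ 2 P := fun t i => (hηL t i).toLp (fun ω => η t ω i)
  set X : ℝ → Fin n → Lp ℝ 2 P := fun t i => (hxL t i).toLp (fun ω => x t ω i)
  obtain ⟨MN, hMN⟩ := exists_norm_toLp_le hηL hηb
  obtain ⟨MX, hMX⟩ := exists_norm_toLp_le hxL hxb
  have hBsub : ∀ s t i, B t i - B s i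
      = (hW.memLp_sub s t i).toLp (fun ω => W t ω i - W s ω i) := fun _ _ _ => rfl
  have hcov : ∀ s t i j, s ≤ t →
      inner ℝ (B t i - B s i) (B t j - B s j) = if i = j then t - s else 0 := by
    intro s t i j hst
    rw [hBsub, hBsub, inner_toLp_toLp, hW.integral_sub_mul_sub hst]
  have hBcont : ∀ i, Continuous fun t => B t i := by
    intro i
    refine continuous_iff_continuousAt.2 fun s => ?_
    rw [ContinuousAt, tendsto_iff_norm_sub_tendsto_zero]
    have h1 : ∀ t, ‖B t i - B s i‖ = Real.sqrt |t - s| := by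
      intro t
      rcases le_total s t with hst | hst
      · have h2 := hcov s t i i hst
        rw [if_pos rfl, real_inner_self_eq_norm_sq] at h2
        rw [abs_of_nonneg (sub_nonneg.2 hst), ← h2, Real.sqrt_sq (norm_nonneg _)]
      · have h2 := hcov t s i i hst
        rw [if_pos rfl, real_inner_self_eq_norm_sq] at h2
        rw [abs_sub_comm, abs_of_nonneg (sub_nonneg.2 hst), norm_sub_rev, ← h2,
          Real.sqrt_sq (norm_nonneg _)]
    simp only [h1]
    have : Continuous fun t => Real.sqrt |t - s| := by fun_prop
    simpa using this.tendsto s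
  -- the regular part of the noise
  have hgL : ∀ i t, MemLp (fun ω => -(1 / γ) * η t ω i) 2 P := fun i t =>
    (hηL t i).const_mul _
  have hpL : ∀ i t, MemLp (fun ω => η t ω i - (1 / γ) * W t ω i) 2 P := fun i t =>
    (hηL t i).sub ((hWL t i).const_mul _)
  have hgc : ∀ i, ∀ᵐ ω ∂P, Continuous fun t => -(1 / γ) * η t ω i := fun i => by
    filter_upwards [hη.continuous] with ω hω
    fun_prop
  have hpg : ∀ i, ∀ᵐ ω ∂P, ∀ s t, (η t ω i - (1 / γ) * W t ω i)
      - (η s ω i - (1 / γ) * W s ω i) = ∫ u in s..t, -(1 / γ) * η u ω i := fun i => by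
    filter_upwards [hη.equation, hη.continuous] with ω he hc s t
    have h1 := congrFun (he s t) i
    have h2 : (∫ v in s..t, -(1 / γ) • η v ω) i = ∫ v in s..t, -(1 / γ) * η v ω i :=
      ((ContinuousLinearMap.proj (R := ℝ) (φ := fun _ : Fin n => ℝ) i
        ).intervalIntegral_comp_comm (μ := volume) (f := fun v => -(1 / γ) • η v ω)
        (Continuous.intervalIntegrable (by fun_prop) s t)).symm
    simp only [Pi.add_apply, Pi.sub_apply, Pi.smul_apply, smul_eq_mul, h2] at h1
    linarith
  have hg : ∀ i t, (hgL i t).toLp (fun ω => -(1 / γ) * η t ω i) = -(1 / γ) • N t i :=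
    fun _ _ => rfl
  have hp : ∀ i t, (hpL i t).toLp (fun ω => η t ω i - (1 / γ) * W t ω i)
      = N t i - (1 / γ) • B t i := fun _ _ => rfl
  -- Mean square differentiability requires a mean square continuous integrand. Continuity comes
  -- first, from the Lipschitz bound that uniform second moments give; the same order is followed
  -- for `X`.
  have hNcont : ∀ i, Continuous fun t => N t i := by
    intro i
    have h1 : Continuous fun t => N t i - (1 / γ) • B t i := by
      refine continuous_of_norm_sub_le (M := ‖-(1 / γ)‖ * MN) fun s t => ?_
      rw [← hp, ← hp]
      refine norm_toLp_sub_toLp_le (hpL i) (hgL i) (hgc i) (hpg i) fun u _ => ?_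
      rw [hg, norm_smul]
      exact mul_le_mul_of_nonneg_left (hMN u i) (norm_nonneg _)
    have h2 := h1.add ((hBcont i).const_smul (1 / γ))
    refine h2.congr fun t => ?_
    simp
  have hderivN : ∀ t i, HasDerivAt (fun t => N t i - (1 / γ) • B t i) (-(1 / γ) • N t i) t := by
    intro t i
    exact hasDerivAt_toLp (hpL i) (hgL i) (hgc i) (hpg i) ((hNcont i).const_smul (-(1 / γ))) t
  -- the solution
  set S := sqrtTwo Q
  have hfL : ∀ i t, MemLp (fun ω => ∑ k, A i k * x t ω k + ∑ k, S i k * η t ω k) 2 P :=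
    fun i t => (memLp_finsetSum _ fun k _ => (hxL t k).const_mul _).add
      (memLp_finsetSum _ fun k _ => (hηL t k).const_mul _)
  have hf : ∀ i t, (hfL i t).toLp (fun ω => ∑ k, A i k * x t ω k + ∑ k, S i k * η t ω k)
      = ∑ k, A i k • X t k + ∑ k, S i k • N t k := by
    intro i t
    rw [← toLp_sum_mul (hxL t), ← toLp_sum_mul (hηL t)]
    rfl
  have hxc : ∀ᵐ ω ∂P, Continuous fun t => x t ω := by
    filter_upwards [hx.equation] with ω he
    exact continuous_iff_continuousAt.2 fun t => (he t).continuousAt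
  have hfc : ∀ i, ∀ᵐ ω ∂P,
      Continuous fun t => ∑ k, A i k * x t ω k + ∑ k, S i k * η t ω k := fun i => by
    filter_upwards [hxc, hη.continuous] with ω h1 h2
    fun_prop
  have hxf : ∀ i, ∀ᵐ ω ∂P, ∀ s t, x t ω i - x s ω i
      = ∫ u in s..t, (∑ k, A i k * x u ω k + ∑ k, S i k * η u ω k) := fun i => by
    filter_upwards [hx.equation, hfc i] with ω he hc s t
    exact (intervalIntegral.integral_eq_sub_of_hasDerivAt (f := fun u => x u ω i)
      (fun u _ => hasDerivAt_pi.1 (he u) i) (hc.intervalIntegrable _ _)).symm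
  have hXcont : ∀ i, Continuous fun t => X t i := by
    intro i
    refine continuous_of_norm_sub_le (M := ∑ k, ‖A i k‖ * MX + ∑ k, ‖S i k‖ * MN) fun s t => ?_
    refine norm_toLp_sub_toLp_le (fun t => hxL t i) (hfL i) (hfc i) (hxf i) fun u _ => ?_
    rw [hf]
    refine (norm_add_le _ _).trans (add_le_add ?_ ?_)
    · refine (norm_sum_le _ _).trans (Finset.sum_le_sum fun k _ => ?_)
      rw [norm_smul]
      exact mul_le_mul_of_nonneg_left (hMX u k) (norm_nonneg _)
    · refine (norm_sum_le _ _).trans (Finset.sum_le_sum fun k _ => ?_)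
      rw [norm_smul]
      exact mul_le_mul_of_nonneg_left (hMN u k) (norm_nonneg _)
  have hderivX : ∀ t i, HasDerivAt (fun t => X t i)
      (∑ k, A i k • X t k + ∑ k, S i k • N t k) t := by
    intro t i
    rw [← hf]
    refine hasDerivAt_toLp (fun t => hxL t i) (hfL i) (hfc i) (hxf i) ?_ t
    simp only [hf]
    fun_prop
  refine ⟨hxL, B, N, hNcont, ⟨MN, hMN⟩, ⟨MX, hMX⟩, hderivN, hderivX, fun t i j => ?_,
    fun t τ i j => ?_, fun r s t i j hrs hst => ?_, hcov⟩
  · rw [inner_toLp_toLp, inner_toLp_toLp]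
    simpa using (hη.stationary.identDistrib_pair 0 t i j).integral_eq
  · rw [inner_toLp_toLp, inner_toLp_toLp]
    exact (hx.stationary.identDistrib_pair τ t i j).integral_eq
  · rw [hBsub, hBsub, inner_toLp_toLp, hW.integral_sub_mul_sub_eq_zero hrs hst]

end ColoredLIM

/-! ### The theorem. -/

theorem mainTheorem3 {Ω : Type*} [MeasurableSpace Ω] (P : Measure Ω) [IsProbabilityMeasure P]
    {n : ℕ} (A Q : Matrix (Fin n) (Fin n) ℝ) (γ : ℝ) (hγ : 0 < γ)
    (hA : ColoredLIM.IsDissipative A) (hQ : Q.PosDef)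
    (W η x : ℝ → Ω → Fin n → ℝ)
    (hW : ColoredLIM.IsBrownianMotion W P)
    (hη : ColoredLIM.IsColoredNoise γ W η P)
    (hx : ColoredLIM.IsStationarySolution A Q η x P) :
    -- second moments are finite, and the correlation function depends on the lag only
    (∀ (t : ℝ) (i : Fin n), MemLp (fun ω => x t ω i) 2 P) ∧
    (∀ (t τ : ℝ) (i j : Fin n),
      ∫ ω, x (t + τ) ω i * x t ω j ∂P = ColoredLIM.corr x P τ i j) ∧
    -- the correlation function is twice continuously differentiable, also across lag zero
    (∀ i j : Fin n, ContDiff ℝ 2 fun τ => ColoredLIM.corr x P τ i j) ∧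
    -- the second-derivative identity
    ColoredLIM.ColoredDynamics γ (ColoredLIM.corr x P) A ∧
    -- the fluctuation-dissipation relation, in which the inverse is a genuine one
    IsUnit (1 - γ • A) ∧
    ColoredLIM.ColoredFDR γ (ColoredLIM.corr x P) A Q ∧
    -- the identity alone determines the dynamics matrix
    (∀ A' : Matrix (Fin n) (Fin n) ℝ,
      ColoredLIM.ColoredDynamics γ (ColoredLIM.corr x P) A' → A' = A) ∧
    -- the two relations together determine both matrices
    (∀ A' Q' : Matrix (Fin n) (Fin n) ℝ, Q'.IsSymm →
      ColoredLIM.ColoredDynamics γ (ColoredLIM.corr x P) A' →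
      ColoredLIM.ColoredFDR γ (ColoredLIM.corr x P) A' Q' → A' = A ∧ Q' = Q) := by
  obtain ⟨hX, B, N, hN, h⟩ := ColoredLIM.exists_meanSquareModel hγ hA hW hη hx
  have hK : ∀ τ i j, ColoredLIM.corr x P τ i j
      = inner ℝ ((hX τ i).toLp (fun ω => x τ ω i)) ((hX 0 j).toLp (fun ω => x 0 ω j)) :=
    fun τ i j => (ColoredLIM.inner_toLp_toLp _ _).symm
  obtain ⟨hdyn, hfdr, hunit⟩ := h.corr_relations hγ hA hQ hK
  have huniq : ∀ A' : Matrix (Fin n) (Fin n) ℝ,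
      ColoredLIM.ColoredDynamics γ (ColoredLIM.corr x P) A' → A' = A :=
    fun A' hA' => hdyn.unique hunit hA'
  have hQs : Q.IsSymm := by
    simpa [Matrix.IsHermitian, Matrix.IsSymm, Matrix.conjTranspose_eq_transpose_of_trivial]
      using hQ.isHermitian
  refine ⟨hX, fun t τ i j => (hx.stationary.identDistrib_pair τ t i j).integral_eq,
    h.contDiff_corr hN hK, hdyn, hA.isUnit_one_sub hγ, hfdr, huniq,
    fun A' Q' hQ' hA' hF => ?_⟩
  -- The first relation already identifies the matrices, so dissipativity is available when the
  -- second relation is used to compare `Q'` with `Q`.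
  obtain rfl := huniq A' hA'
  exact ⟨rfl, hfdr.unique hγ hA hQs hQ' hF⟩
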